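/- **Language.** Consider a two-sorted first-order language with sorts $\omega$ (containing $0$ and $s$) and $\iota$, with constant (uninterpreted) function and predicate symbols, and with defined function and predicate symbols. Each defined function symbol $f$ is given by primitive recursive rewrite rules $f(0,\bar x)\to u$, $f(s(y),\bar x)\to t[f(y,\bar x)]$, where $u$ and $t[\cdot]$ contain only defined function symbols that are smaller than $f$ in a well-founded order; each defined predicate symbol is given by rules of the same form whose right-hand sides are formulas. Arithmetic terms are built from the parameter (and, in rewrite rules, the arithmetic variables of the rule) by $0$, $s$ and defined function symbols with arithmetic values; they are in particular terms of sort $\omega$. Recursion arguments of defined symbols are arithmetic terms, and so are the indices $t$ of schematic variables $X(t)$ of sort $\iota$; for a number $m$, $X(m)$ stands for a first-order variable, different variables for different pairs $(X,m)$. Let $\mathcal E$ be the set of rewrite rules, read as equations. **Proof schemata.** $\mathbf{LKS}_{\mathcal E}$ is the sequent calculus $\mathbf{LK}$ on multiset sequents, with axioms $A\vdash A$ for atomic $A$, with cut, and with the rule that replaces expressions by $\mathcal E$-equal ones, where moreover proof links $\psi(a,\bar a)$ with sequent $S(a,\bar a)$ may stand at leaves. A proof schema $\Psi$ consists of pairs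 $(\pi_\beta,\nu_\beta(k))$, $1\le\beta\le\alpha$ ($\alpha\ge1$), for proof symbols $\psi_\beta$ with end-sequents $S_\beta(n,\bar x)$, where $n$ is the only arithmetic variable. Here $\pi_\beta$ is a proof of $S_\beta(0,\bar x)$ and $\nu_\beta(k)$ is a proof of $S_\beta(k+1,\bar x)$; $\nu_\beta(k)$ may contain links $\psi_\beta(k,\bar a)$; both may contain links $\psi_\delta(a,\bar a)$ with $\beta<\delta\le\alpha$, where $a$ is an arithmetic term containing at most the variable $k$ (no variable in $\pi_\beta$). For $\gamma\in\mathbb N$, the evaluation $\Psi{\downarrow_\gamma}$ is the normal form of $\psi_1(\gamma,\bar x)$ under the rules $\psi_\beta(0,\bar x)\to\pi_\beta$, $\psi_\beta(k+1,\bar x)\to\nu_\beta(k)$ and the rules for the defined symbols. $\Psi$ is *regular* if for every $\gamma$ the proof $\Psi{\downarrow_\gamma}$ is regular: distinct strong quantifier inferences have distinct eigenvariables, and the eigenvariable of an inference occurs only in sequents above that inference. **Characteristic clause sets.** A configuration $\Omega$ for a proof is a set of formula occurrences in its end-sequent. The characteristic term $\Theta(\pi,\Omega)$ is defined by recursion on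 $\pi$: an axiom yields $[C]$, where $C$ is its subsequent consisting of the ancestors of occurrences in $\Omega$ or of cut formulas; a link $\psi(a,\bar a)$ yields $\mathrm{cl}^{\psi,\Omega'}(a,\bar a)$, where $\Omega'$ is the set of those occurrences in its sequent that are such ancestors; unary inferences change nothing; a binary inference yields $\Theta_1\oplus\Theta_2$ if its auxiliary formulas are such ancestors, and $\Theta_1\otimes\Theta_2$ otherwise. $\Theta(\Psi){\downarrow_\gamma}$ is the normal form of $\mathrm{cl}^{\psi_1,\emptyset}(\gamma,\bar x)$ under the rules $\mathrm{cl}^{\psi_\beta,\Omega}(0,\bar x)\to\Theta(\pi_\beta,\Omega)$, $\mathrm{cl}^{\psi_\beta,\Omega}(k+1,\bar x)\to\Theta(\nu_\beta(k),\Omega)$ and the rules for the defined symbols. Let $|[C]|=\{C\}$, $|t_1\oplus t_2|=|t_1|\cup|t_2|$, and let $|t_1\otimes t_2|$ be the set of all merges $C_1\circ C_2$ with $C_i\in|t_i|$, where $(\Gamma\vdash\Delta)\circ(\Gamma'\vdash\Delta')=(\Gamma,\Gamma'\vdash\Delta,\Delta')$. Put $\mathrm{CL}(\Psi){\downarrow_\gamma}=|\Theta(\Psi){\downarrow_\gamma}|$.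 **Proposition.** Let $\Psi$ be a regular proof schema. Then for every $\gamma\in\mathbb N$ the set $\mathrm{CL}(\Psi){\downarrow_\gamma}$ is unsatisfiable: there is no two-sorted first-order structure (with non-empty domains, interpreting $0$, $s$ and the constant symbols arbitrarily) in which all members of $\mathrm{CL}(\Psi){\downarrow_\gamma}$ are true under all assignments of values to their free variables. -/

import Mathlib

/-! Proof schemata over a schematic two-sorted first-order language, their evaluation, and their
schematic characteristic clause sets. -/

universe u

namespace Ceres

/-! ### The schematic language -/

/-- The two sorts: `omega` (intended: numbers) and `iota` (an arbitrary first-order domain). -/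
inductive Srt : Type
  | omega
  | iota

/-- Kinds of schematic expressions.  `fo s`: terms of sort `s`.  `arith`: arithmetic terms, i.e.
those terms of sort `omega` whose value is a numeral as soon as the arithmetic variables (such as the
parameter) are numbers; recursion arguments of defined symbols and indices of schematic variables
are of this kind, so that evaluation eliminates all defined symbols.  `seq`: variable function
symbols, of type `omega → iota`. -/
inductive Kind : Type
  | arith
  | fo (s : Srt)
  | seq

/-- Symbols.  `Fn`, `Rel` are the constant function and predicate symbols (besides `0` and `s`).
`DFn`, `DRel` are the defined ones; a defined symbol has a first, arithmetic argument (the recursion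
argument), and `dfargs`, `drargs` list the kinds of the others.  `fprec`, `rprec` are the orders
`≺`. -/
structure Sym where
  Fn : Type
  fargs : Fn → List Srt
  fres : Fn → Srt
  Rel : Type
  rargs : Rel → List Srt
  DFn : Type
  dfargs : DFn → List Kind
  dfres : DFn → Kind
  dfres_ne : ∀ f, dfres f ≠ Kind.seq
  fprec : DFn → DFn → Prop
  fprec_wf : WellFounded fprec
  DRel : Type
  drargs : DRel → List Kind
  rprec : DRel → DRel → Prop
  rprec_wf : WellFounded rprec

/-- Terms with variables from `V`, in which only the defined function symbols satisfying `ok`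
occur.  `app X t` is the schematic variable `X(t)`; `num t` is the arithmetic term `t`, seen as a
term of sort `omega` (so `num azero` is the constant `0` of sort `omega`). -/
inductive Tm (L : Sym) (ok : L.DFn → Prop) (V : Kind → Type) : Kind → Type
  | var {κ : Kind} (x : V κ) : Tm L ok V κ
  | app (X : Tm L ok V .seq) (t : Tm L ok V .arith) : Tm L ok V (.fo .iota)
  | azero : Tm L ok V .arith
  | asucc (t : Tm L ok V .arith) : Tm L ok V .arith
  | num (t : Tm L ok V .arith) : Tm L ok V (.fo .omega)
  | succ (t : Tm L ok V (.fo .omega)) : Tm L ok V (.fo .omega)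
  | fn (f : L.Fn) (args : ∀ i : Fin (L.fargs f).length, Tm L ok V (.fo ((L.fargs f).get i))) :
      Tm L ok V (.fo (L.fres f))
  | dfn (f : L.DFn) (h : ok f) (t : Tm L ok V .arith)
      (args : ∀ i : Fin (L.dfargs f).length, Tm L ok V ((L.dfargs f).get i)) :
      Tm L ok V (L.dfres f)

/-- Variables extended by one new variable of sort `s`. -/
inductive Bind (V : Kind → Type) (s : Srt) : Kind → Type
  | old {κ : Kind} (x : V κ) : Bind V s κ
  | new : Bind V s (.fo s)

/-- Formulas with free variables from `V`, in which only the defined predicate symbols satisfying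
`ok` occur.  If `hole` holds, the place-holder `call` may be used: it stands for the recursive call
in the definition of a defined predicate symbol. -/
inductive Fm (L : Sym) (ok : L.DRel → Prop) (hole : Prop) : (Kind → Type) → Type 1
  | rel {V : Kind → Type} (R : L.Rel)
      (args : ∀ i : Fin (L.rargs R).length,
        Tm L (fun _ => True) V (.fo ((L.rargs R).get i))) : Fm L ok hole V
  | drel {V : Kind → Type} (R : L.DRel) (h : ok R) (t : Tm L (fun _ => True) V .arith)
      (args : ∀ i : Fin (L.drargs R).length, Tm L (fun _ => True) V ((L.drargs R).get i)) :
      Fm L ok hole V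
  | call {V : Kind → Type} (h : hole) : Fm L ok hole V
  | neg {V : Kind → Type} (A : Fm L ok hole V) : Fm L ok hole V
  | and {V : Kind → Type} (A B : Fm L ok hole V) : Fm L ok hole V
  | or {V : Kind → Type} (A B : Fm L ok hole V) : Fm L ok hole V
  | imp {V : Kind → Type} (A B : Fm L ok hole V) : Fm L ok hole V
  | all {V : Kind → Type} (s : Srt) (A : Fm L ok hole (Bind V s)) : Fm L ok hole V
  | ex {V : Kind → Type} (s : Srt) (A : Fm L ok hole (Bind V s)) : Fm L ok hole V

/-- Terms of the schematic language. -/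
abbrev Term (L : Sym) (V : Kind → Type) (κ : Kind) : Type := Tm L (fun _ => True) V κ

/-- Formulas of the schematic language. -/
abbrev Form (L : Sym) (V : Kind → Type) : Type 1 := Fm L (fun _ => True) False V

/-- Variables of the base rule `f(0, x₁, …, xₙ) → s`. -/
inductive BaseVar (ps : List Kind) : Kind → Type
  | arg (i : Fin ps.length) : BaseVar ps (ps.get i)

/-- Variables of the step rule `f(s(y), x₁, …, xₙ) → t`: the `xᵢ` and `y`. -/
inductive StepVar (ps : List Kind) : Kind → Type
  | arg (i : Fin ps.length) : StepVar ps (ps.get i)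
  | pred : StepVar ps .arith

/-- The variables of the step rule, and a place-holder for the term `f(y, x₁, …, xₙ)`. -/
inductive RecVar (ps : List Kind) (r : Kind) : Kind → Type
  | arg (i : Fin ps.length) : RecVar ps r (ps.get i)
  | pred : RecVar ps r .arith
  | call : RecVar ps r r

/-- The primitive recursive rewrite rules of the defined symbols: the right-hand sides only contain
defined symbols that are `≺`-smaller than the defined one. -/
structure Rules (L : Sym) : Type 1 where
  fbase : ∀ f : L.DFn, Tm L (fun g => L.fprec g f) (BaseVar (L.dfargs f)) (L.dfres f)
  fstep : ∀ f : L.DFn,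
    Tm L (fun g => L.fprec g f) (RecVar (L.dfargs f) (L.dfres f)) (L.dfres f)
  rbase : ∀ R : L.DRel, Fm L (fun Q => L.rprec Q R) False (BaseVar (L.drargs R))
  rstep : ∀ R : L.DRel, Fm L (fun Q => L.rprec Q R) True (StepVar (L.drargs R))

/-! ### Substitution -/

section Substitution

variable {L : Sym}

/-- Simultaneous substitution in terms. -/
def Tm.subst {ok ok' : L.DFn → Prop} {V W : Kind → Type} (h : ∀ f, ok f → ok' f)
    (σ : ∀ κ, V κ → Tm L ok' W κ) : ∀ {κ : Kind}, Tm L ok V κ → Tm L ok' W κ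
  | _, .var x => σ _ x
  | _, .app X t => .app (X.subst h σ) (t.subst h σ)
  | _, .azero => .azero
  | _, .asucc t => .asucc (t.subst h σ)
  | _, .num t => .num (t.subst h σ)
  | _, .succ t => .succ (t.subst h σ)
  | _, .fn f args => .fn f (fun i => (args i).subst h σ)
  | _, .dfn f hf t args => .dfn f (h f hf) (t.subst h σ) (fun i => (args i).subst h σ)

/-- Renaming of variables under one more binder. -/
def liftRen {V W : Kind → Type} (s : Srt) (r : ∀ κ, V κ → W κ) :
    ∀ κ, Bind V s κ → Bind W s κ
  | _, .old x => .old (r _ x)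
  | _, .new => .new

/-- Substitution under one more binder. -/
def liftSub {V W : Kind → Type} (s : Srt) (σ : ∀ κ, V κ → Term L W κ) :
    ∀ κ, Bind V s κ → Term L (Bind W s) κ
  | _, .old x => (σ _ x).subst (fun _ h => h) (fun _ y => .var (.old y))
  | _, .new => .var .new

/-- Renaming of free variables in formulas. -/
def Fm.rename {ok : L.DRel → Prop} {hole : Prop} :
    ∀ {V W : Kind → Type}, (∀ κ, V κ → W κ) → Fm L ok hole V → Fm L ok hole W
  | _, _, r, .rel R args => .rel R (fun i => (args i).subst (fun _ h => h) fun _ x => .var (r _ x))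
  | _, _, r, .drel R h t args =>
      .drel R h (t.subst (fun _ h => h) fun _ x => .var (r _ x))
        (fun i => (args i).subst (fun _ h => h) fun _ x => .var (r _ x))
  | _, _, _, .call h => .call h
  | _, _, r, .neg A => .neg (A.rename r)
  | _, _, r, .and A B => .and (A.rename r) (B.rename r)
  | _, _, r, .or A B => .or (A.rename r) (B.rename r)
  | _, _, r, .imp A B => .imp (A.rename r) (B.rename r)
  | _, _, r, .all s A => .all s (A.rename (liftRen s r))
  | _, _, r, .ex s A => .ex s (A.rename (liftRen s r))

/-- Simultaneous (capture-avoiding) substitution of terms for the free variables, and of a formula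
for the place-holder `call`. -/
def Fm.inst {ok ok' : L.DRel → Prop} {hole hole' : Prop} (hok : ∀ R, ok R → ok' R) :
    ∀ {V W : Kind → Type}, (hole → Fm L ok' hole' W) → (∀ κ, V κ → Term L W κ) →
      Fm L ok hole V → Fm L ok' hole' W
  | _, _, _, σ, .rel R args => .rel R (fun i => (args i).subst (fun _ h => h) σ)
  | _, _, _, σ, .drel R h t args =>
      .drel R (hok R h) (t.subst (fun _ h => h) σ) (fun i => (args i).subst (fun _ h => h) σ)
  | _, _, c, _, .call h => c h
  | _, _, c, σ, .neg A => .neg (A.inst hok c σ)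
  | _, _, c, σ, .and A B => .and (A.inst hok c σ) (B.inst hok c σ)
  | _, _, c, σ, .or A B => .or (A.inst hok c σ) (B.inst hok c σ)
  | _, _, c, σ, .imp A B => .imp (A.inst hok c σ) (B.inst hok c σ)
  | _, _, c, σ, .all s A =>
      .all s (A.inst hok (fun h => (c h).rename fun _ x => .old x) (liftSub s σ))
  | _, _, c, σ, .ex s A =>
      .ex s (A.inst hok (fun h => (c h).rename fun _ x => .old x) (liftSub s σ))

/-- Substitution in formulas of the schematic language. -/
def subst {V W : Kind → Type} (σ : ∀ κ, V κ → Term L W κ) (A : Form L V) : Form L W :=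
  A.inst (fun _ h => h) (fun h => h.elim) σ

/-- The substitution replacing the newest variable by `t`. -/
def newSub {V : Kind → Type} {s : Srt} (t : Term L V (.fo s)) :
    ∀ κ, Bind V s κ → Term L V κ
  | _, .old x => .var x
  | _, .new => t

/-- `A(t)`, for a formula `A(x)`. -/
def instantiate {V : Kind → Type} {s : Srt} (A : Form L (Bind V s)) (t : Term L V (.fo s)) :
    Form L V :=
  subst (newSub t) A

/-- The term `t`, seen under one more binder. -/
def weakenTerm {V : Kind → Type} (s : Srt) {κ : Kind} (t : Term L V κ) : Term L (Bind V s) κ :=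
  t.subst (fun _ h => h) fun _ x => .var (.old x)

/-- The term `e` occurs as a subterm in a term. -/
inductive Tm.Occ {V : Kind → Type} {κ₀ : Kind} (e : Term L V κ₀) : ∀ {κ : Kind}, Term L V κ → Prop
  | self : Tm.Occ e e
  | app_sym {X t} (h : Tm.Occ e X) : Tm.Occ e (.app X t)
  | app_idx {X t} (h : Tm.Occ e t) : Tm.Occ e (.app X t)
  | asucc {t} (h : Tm.Occ e t) : Tm.Occ e (.asucc t)
  | num {t} (h : Tm.Occ e t) : Tm.Occ e (.num t)
  | succ {t} (h : Tm.Occ e t) : Tm.Occ e (.succ t)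
  | fn {f args} (i) (h : Tm.Occ e (args i)) : Tm.Occ e (.fn f args)
  | dfn_rec {f hf t args} (h : Tm.Occ e t) : Tm.Occ e (.dfn f hf t args)
  | dfn_arg {f hf t args} (i) (h : Tm.Occ e (args i)) : Tm.Occ e (.dfn f hf t args)

/-- The term `e` occurs in a formula. -/
inductive Fm.Occ {κ₀ : Kind} : ∀ {V : Kind → Type}, Term L V κ₀ → Form L V → Prop
  | rel {V : Kind → Type} {e : Term L V κ₀} {R args} (i) (h : Tm.Occ e (args i)) :
      Fm.Occ e (.rel R args)
  | drel_rec {V : Kind → Type} {e : Term L V κ₀} {R hR t args} (h : Tm.Occ e t) :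
      Fm.Occ e (.drel R hR t args)
  | drel_arg {V : Kind → Type} {e : Term L V κ₀} {R hR t args} (i) (h : Tm.Occ e (args i)) :
      Fm.Occ e (.drel R hR t args)
  | neg {V : Kind → Type} {e : Term L V κ₀} {A} (h : Fm.Occ e A) : Fm.Occ e (.neg A)
  | and_left {V : Kind → Type} {e : Term L V κ₀} {A B} (h : Fm.Occ e A) : Fm.Occ e (.and A B)
  | and_right {V : Kind → Type} {e : Term L V κ₀} {A B} (h : Fm.Occ e B) : Fm.Occ e (.and A B)
  | or_left {V : Kind → Type} {e : Term L V κ₀} {A B} (h : Fm.Occ e A) : Fm.Occ e (.or A B)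
  | or_right {V : Kind → Type} {e : Term L V κ₀} {A B} (h : Fm.Occ e B) : Fm.Occ e (.or A B)
  | imp_left {V : Kind → Type} {e : Term L V κ₀} {A B} (h : Fm.Occ e A) : Fm.Occ e (.imp A B)
  | imp_right {V : Kind → Type} {e : Term L V κ₀} {A B} (h : Fm.Occ e B) : Fm.Occ e (.imp A B)
  | all {V : Kind → Type} {e : Term L V κ₀} {s : Srt} {A : Form L (Bind V s)}
      (h : Fm.Occ (weakenTerm s e) A) : Fm.Occ e (.all s A)
  | ex {V : Kind → Type} {e : Term L V κ₀} {s : Srt} {A : Form L (Bind V s)}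
      (h : Fm.Occ (weakenTerm s e) A) : Fm.Occ e (.ex s A)

/-- Atomic formulas. -/
def Fm.IsAtom {V : Kind → Type} : Form L V → Prop
  | .rel _ _ => True
  | .drel _ _ _ _ => True
  | _ => False

/-! ### The equational theory of the rewrite rules -/

/-- The substitution `xᵢ := args i` for the base rule. -/
def baseSub {V : Kind → Type} {ps : List Kind} (args : ∀ i : Fin ps.length, Term L V (ps.get i)) :
    ∀ κ, BaseVar ps κ → Term L V κ
  | _, .arg i => args i

/-- The substitution `xᵢ := args i`, `y := t` for the step rule of a predicate symbol. -/
def stepSub {V : Kind → Type} {ps : List Kind} (args : ∀ i : Fin ps.length, Term L V (ps.get i))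
    (t : Term L V .arith) : ∀ κ, StepVar ps κ → Term L V κ
  | _, .arg i => args i
  | _, .pred => t

/-- The substitution `xᵢ := args i`, `y := t`, and of `c` for the recursive call. -/
def recSub {V : Kind → Type} {ps : List Kind} {r : Kind}
    (args : ∀ i : Fin ps.length, Term L V (ps.get i))
    (t : Term L V .arith) (c : Term L V r) : ∀ κ, RecVar ps r κ → Term L V κ
  | _, .arg i => args i
  | _, .pred => t
  | _, .call => c

/-- Equality of terms in the equational theory: the congruence generated by the rewrite
rules (and by the identification of `s(t)` as an arithmetic term and as a term of sort `omega`). -/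
inductive TmEq (E : Rules L) {V : Kind → Type} : ∀ {κ : Kind}, Term L V κ → Term L V κ → Prop
  | refl {κ : Kind} (t : Term L V κ) : TmEq E t t
  | symm {κ : Kind} {t t' : Term L V κ} (h : TmEq E t t') : TmEq E t' t
  | trans {κ : Kind} {t t' t'' : Term L V κ} (h : TmEq E t t') (h' : TmEq E t' t'') : TmEq E t t''
  | app {X X' : Term L V .seq} {t t' : Term L V .arith} (h : TmEq E X X') (h' : TmEq E t t') :
      TmEq E (.app X t) (.app X' t')
  | asucc {t t' : Term L V .arith} (h : TmEq E t t') : TmEq E (.asucc t) (.asucc t')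
  | num {t t' : Term L V .arith} (h : TmEq E t t') : TmEq E (.num t) (.num t')
  | succ {t t' : Term L V (.fo .omega)} (h : TmEq E t t') : TmEq E (.succ t) (.succ t')
  | fn {f : L.Fn} {args args' : ∀ i : Fin (L.fargs f).length, Term L V (.fo ((L.fargs f).get i))}
      (h : ∀ i, TmEq E (args i) (args' i)) : TmEq E (.fn f args) (.fn f args')
  | dfn {f : L.DFn} {hf : True} {t t' : Term L V .arith}
      {args args' : ∀ i : Fin (L.dfargs f).length, Term L V ((L.dfargs f).get i)}
      (h : TmEq E t t') (h' : ∀ i, TmEq E (args i) (args' i)) :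
      TmEq E (.dfn f hf t args) (.dfn f hf t' args')
  | num_succ (t : Term L V .arith) : TmEq E (.num (.asucc t)) (.succ (.num t))
  | rule_base (f : L.DFn) (args : ∀ i : Fin (L.dfargs f).length, Term L V ((L.dfargs f).get i)) :
      TmEq E (.dfn f trivial .azero args)
        ((E.fbase f).subst (fun _ _ => trivial) (baseSub args))
  | rule_step (f : L.DFn) (t : Term L V .arith)
      (args : ∀ i : Fin (L.dfargs f).length, Term L V ((L.dfargs f).get i)) :
      TmEq E (.dfn f trivial (.asucc t) args)
        ((E.fstep f).subst (fun _ _ => trivial) (recSub args t (.dfn f trivial t args)))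

/-- Equality of formulas in the equational theory: the congruence generated by the rewrite rules. -/
inductive FmEq (E : Rules L) : ∀ {V : Kind → Type}, Form L V → Form L V → Prop
  | refl {V : Kind → Type} (A : Form L V) : FmEq E A A
  | symm {V : Kind → Type} {A B : Form L V} (h : FmEq E A B) : FmEq E B A
  | trans {V : Kind → Type} {A B C : Form L V} (h : FmEq E A B) (h' : FmEq E B C) : FmEq E A C
  | rel {V : Kind → Type} {R : L.Rel}
      {args args' : ∀ i : Fin (L.rargs R).length, Term L V (.fo ((L.rargs R).get i))}
      (h : ∀ i, TmEq E (args i) (args' i)) : FmEq E (.rel R args) (.rel R args')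
  | drel {V : Kind → Type} {R : L.DRel} {hR : True} {t t' : Term L V .arith}
      {args args' : ∀ i : Fin (L.drargs R).length, Term L V ((L.drargs R).get i)}
      (h : TmEq E t t') (h' : ∀ i, TmEq E (args i) (args' i)) :
      FmEq E (.drel R hR t args) (.drel R hR t' args')
  | neg {V : Kind → Type} {A A' : Form L V} (h : FmEq E A A') : FmEq E (.neg A) (.neg A')
  | and {V : Kind → Type} {A A' B B' : Form L V} (h : FmEq E A A') (h' : FmEq E B B') :
      FmEq E (.and A B) (.and A' B')
  | or {V : Kind → Type} {A A' B B' : Form L V} (h : FmEq E A A') (h' : FmEq E B B') :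
      FmEq E (.or A B) (.or A' B')
  | imp {V : Kind → Type} {A A' B B' : Form L V} (h : FmEq E A A') (h' : FmEq E B B') :
      FmEq E (.imp A B) (.imp A' B')
  | all {V : Kind → Type} {s : Srt} {A A' : Form L (Bind V s)} (h : FmEq E A A') :
      FmEq E (.all s A) (.all s A')
  | ex {V : Kind → Type} {s : Srt} {A A' : Form L (Bind V s)} (h : FmEq E A A') :
      FmEq E (.ex s A) (.ex s A')
  | rule_base {V : Kind → Type} (R : L.DRel)
      (args : ∀ i : Fin (L.drargs R).length, Term L V ((L.drargs R).get i)) :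
      FmEq E (.drel R trivial .azero args)
        ((E.rbase R).inst (fun _ _ => trivial) (fun h => h.elim) (baseSub args))
  | rule_step {V : Kind → Type} (R : L.DRel) (t : Term L V .arith)
      (args : ∀ i : Fin (L.drargs R).length, Term L V ((L.drargs R).get i)) :
      FmEq E (.drel R trivial (.asucc t) args)
        ((E.rstep R).inst (fun _ _ => trivial) (fun _ => .drel R trivial t args)
          (stepSub args t))

end Substitution

/-! ### First-order logic: the target of evaluation -/

/-- First-order terms over the constant symbols, with variables from `W`. -/
inductive FOTm (L : Sym) (W : Srt → Type) : Srt → Type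
  | var {s : Srt} (x : W s) : FOTm L W s
  | zero : FOTm L W .omega
  | succ (t : FOTm L W .omega) : FOTm L W .omega
  | fn (f : L.Fn) (args : ∀ i : Fin (L.fargs f).length, FOTm L W ((L.fargs f).get i)) :
      FOTm L W (L.fres f)

/-- Variables extended by one new variable of sort `s`. -/
inductive FOBind (W : Srt → Type) (s : Srt) : Srt → Type
  | old {s' : Srt} (x : W s') : FOBind W s s'
  | new : FOBind W s s

/-- First-order formulas over the constant symbols, with free variables from `W`. -/
inductive FOFm (L : Sym) : (Srt → Type) → Type 1
  | rel {W : Srt → Type} (R : L.Rel)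
      (args : ∀ i : Fin (L.rargs R).length, FOTm L W ((L.rargs R).get i)) : FOFm L W
  | neg {W : Srt → Type} (A : FOFm L W) : FOFm L W
  | and {W : Srt → Type} (A B : FOFm L W) : FOFm L W
  | or {W : Srt → Type} (A B : FOFm L W) : FOFm L W
  | imp {W : Srt → Type} (A B : FOFm L W) : FOFm L W
  | all {W : Srt → Type} (s : Srt) (A : FOFm L (FOBind W s)) : FOFm L W
  | ex {W : Srt → Type} (s : Srt) (A : FOFm L (FOBind W s)) : FOFm L W

section FirstOrder

variable {L : Sym}

/-- The numeral `sⁿ(0)`. -/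
def numeral {W : Srt → Type} : ℕ → FOTm L W .omega
  | 0 => .zero
  | n + 1 => .succ (numeral n)

/-- Renaming of variables in terms. -/
def FOTm.rename {W W' : Srt → Type} (r : ∀ s, W s → W' s) : ∀ {s : Srt}, FOTm L W s → FOTm L W' s
  | _, .var x => .var (r _ x)
  | _, .zero => .zero
  | _, .succ t => .succ (t.rename r)
  | _, .fn f args => .fn f (fun i => (args i).rename r)

/-- Renaming of variables under one more binder. -/
def liftFORen {W W' : Srt → Type} (s : Srt) (r : ∀ s', W s' → W' s') :
    ∀ s', FOBind W s s' → FOBind W' s s'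
  | _, .old x => .old (r _ x)
  | _, .new => .new

/-- Renaming of free variables in formulas. -/
def FOFm.rename : ∀ {W W' : Srt → Type}, (∀ s, W s → W' s) → FOFm L W → FOFm L W'
  | _, _, r, .rel R args => .rel R (fun i => (args i).rename r)
  | _, _, r, .neg A => .neg (A.rename r)
  | _, _, r, .and A B => .and (A.rename r) (B.rename r)
  | _, _, r, .or A B => .or (A.rename r) (B.rename r)
  | _, _, r, .imp A B => .imp (A.rename r) (B.rename r)
  | _, _, r, .all s A => .all s (A.rename (liftFORen s r))
  | _, _, r, .ex s A => .ex s (A.rename (liftFORen s r))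

/-- The variable `x` occurs in a term. -/
inductive FOTm.Occ {W : Srt → Type} {s₀ : Srt} (x : W s₀) : ∀ {s : Srt}, FOTm L W s → Prop
  | var : FOTm.Occ x (.var x)
  | succ {t} (h : FOTm.Occ x t) : FOTm.Occ x (.succ t)
  | fn {f args} (i) (h : FOTm.Occ x (args i)) : FOTm.Occ x (.fn f args)

/-- The variable `x` occurs free in a formula. -/
def FOFm.Occ {s₀ : Srt} : ∀ {W : Srt → Type}, W s₀ → FOFm L W → Prop
  | _, x, .rel _ args => ∃ i, FOTm.Occ x (args i)
  | _, x, .neg A => A.Occ x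
  | _, x, .and A B => A.Occ x ∨ B.Occ x
  | _, x, .or A B => A.Occ x ∨ B.Occ x
  | _, x, .imp A B => A.Occ x ∨ B.Occ x
  | _, x, .all _ A => A.Occ (.old x)
  | _, x, .ex _ A => A.Occ (.old x)

/-- Two-sorted first-order structures for the constant symbols (including `0` and `s`). -/
structure FOStruct (L : Sym) where
  dom : Srt → Type u
  dom_nonempty : ∀ s, Nonempty (dom s)
  zero : dom .omega
  succ : dom .omega → dom .omega
  fn : ∀ f : L.Fn, (∀ i : Fin (L.fargs f).length, dom ((L.fargs f).get i)) → dom (L.fres f)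
  rel : ∀ R : L.Rel, (∀ i : Fin (L.rargs R).length, dom ((L.rargs R).get i)) → Prop

/-- Value of a term. -/
def FOTm.val (M : FOStruct.{u} L) {W : Srt → Type} (v : ∀ s, W s → M.dom s) :
    ∀ {s : Srt}, FOTm L W s → M.dom s
  | _, .var x => v _ x
  | _, .zero => M.zero
  | _, .succ t => M.succ (t.val M v)
  | _, .fn f args => M.fn f (fun i => (args i).val M v)

/-- The assignment extended by the value `d` of the newest variable. -/
def extend (M : FOStruct.{u} L) {W : Srt → Type} (v : ∀ s, W s → M.dom s) {s : Srt}
    (d : M.dom s) : ∀ s', FOBind W s s' → M.dom s'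
  | _, .old x => v _ x
  | _, .new => d

/-- Truth of a formula in a structure, under an assignment. -/
def FOFm.Holds (M : FOStruct.{u} L) :
    ∀ {W : Srt → Type}, (∀ s, W s → M.dom s) → FOFm L W → Prop
  | _, v, .rel R args => M.rel R (fun i => (args i).val M v)
  | _, v, .neg A => ¬ A.Holds M v
  | _, v, .and A B => A.Holds M v ∧ B.Holds M v
  | _, v, .or A B => A.Holds M v ∨ B.Holds M v
  | _, v, .imp A B => A.Holds M v → B.Holds M v
  | _, v, .all _ A => ∀ d, A.Holds M (extend M v d)
  | _, v, .ex _ A => ∃ d, A.Holds M (extend M v d)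

end FirstOrder

/-- The free first-order variables of evaluated proofs: ordinary variables `fv s i`; `sv X n` is the
first-order variable that is denoted by the schematic variable `X(n)`; `par`, `parSeq` are the
formal arguments `xᵢ` of the evaluated proof symbol. -/
inductive FOVar : Srt → Type
  | fv (s : Srt) (i : ℕ) : FOVar s
  | sv (X n : ℕ) : FOVar .iota
  | par (s : Srt) (i : ℕ) : FOVar s
  | parSeq (i n : ℕ) : FOVar .iota

/-- Sequents of first-order formulas.  Those made of atoms are the clauses. -/
structure FOSeq (L : Sym) : Type 1 where
  ant : Multiset (FOFm L FOVar)
  suc : Multiset (FOFm L FOVar)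

/-- The merge `S ∘ S'`. -/
def FOSeq.merge {L : Sym} (S S' : FOSeq L) : FOSeq L := ⟨S.ant + S'.ant, S.suc + S'.suc⟩

/-- The free variable `x` occurs in the sequent. -/
def FOSeq.Occ {L : Sym} (S : FOSeq L) {s : Srt} (x : FOVar s) : Prop :=
  (∃ A ∈ S.ant, A.Occ x) ∨ ∃ A ∈ S.suc, A.Occ x

/-- Truth of a sequent in a structure, under an assignment. -/
def FOSeq.Holds {L : Sym} (M : FOStruct.{u} L) (v : ∀ s, FOVar s → M.dom s) (S : FOSeq L) : Prop :=
  (∀ A ∈ S.ant, A.Holds M v) → ∃ B ∈ S.suc, B.Holds M v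

/-- A set of clauses is satisfiable if in some structure all clauses are true, their free variables
being read as universally quantified. -/
def Satisfiable {L : Sym} (C : Set (FOSeq L)) : Prop :=
  ∃ M : FOStruct.{u} L, ∀ S ∈ C, ∀ v : (∀ s, FOVar s → M.dom s), S.Holds M v

/-! ### Evaluation of schematic expressions

`eval` computes the normal form of an expression with respect to the rewrite rules, after numbers
have been substituted for the arithmetic variables. -/

/-- Values of expressions: numbers for arithmetic terms, first-order terms over the constant
symbols for the terms of the two sorts, sequences of these for variable function symbols. -/
def Val (L : Sym) (W : Srt → Type) : Kind → Type
  | .arith => ℕ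
  | .fo s => FOTm L W s
  | .seq => ℕ → FOTm L W .iota

section Evaluation

variable {L : Sym}

/-- Evaluation of terms, for given values of the defined function symbols. -/
def Tm.eval {ok : L.DFn → Prop} {W : Srt → Type}
    (I : ∀ f, ok f → ℕ → (∀ i : Fin (L.dfargs f).length, Val L W ((L.dfargs f).get i)) →
      Val L W (L.dfres f))
    {V : Kind → Type} (ρ : ∀ κ, V κ → Val L W κ) : ∀ {κ : Kind}, Tm L ok V κ → Val L W κ
  | _, .var x => ρ _ x
  | _, .app X t => (X.eval I ρ : ℕ → FOTm L W .iota) (t.eval I ρ : ℕ)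
  | _, .azero => (0 : ℕ)
  | _, .asucc t => Nat.succ (t.eval I ρ)
  | _, .num t => numeral (t.eval I ρ)
  | _, .succ t => FOTm.succ (t.eval I ρ)
  | _, .fn f args => FOTm.fn f (fun i => (args i).eval I ρ)
  | _, .dfn f h t args => I f h (t.eval I ρ) (fun i => (args i).eval I ρ)

/-- Values of the variables of a base rule. -/
def baseEnv {W : Srt → Type} {ps : List Kind} (args : ∀ i : Fin ps.length, Val L W (ps.get i)) :
    ∀ κ, BaseVar ps κ → Val L W κ
  | _, .arg i => args i

/-- Values of the variables of a step rule. -/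
def stepEnv {W : Srt → Type} {ps : List Kind} (args : ∀ i : Fin ps.length, Val L W (ps.get i))
    (y : ℕ) : ∀ κ, StepVar ps κ → Val L W κ
  | _, .arg i => args i
  | _, .pred => y

/-- Values of the variables of a step rule and of the recursive call. -/
def recEnv {W : Srt → Type} {ps : List Kind} {r : Kind}
    (args : ∀ i : Fin ps.length, Val L W (ps.get i)) (y : ℕ) (c : Val L W r) :
    ∀ κ, RecVar ps r κ → Val L W κ
  | _, .arg i => args i
  | _, .pred => y
  | _, .call => c

/-- The normal form of `f(n, args)`, for a defined function symbol `f`. -/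
noncomputable def fnVal (E : Rules L) {W : Srt → Type} (f : L.DFn) :
    ℕ → (∀ i : Fin (L.dfargs f).length, Val L W ((L.dfargs f).get i)) → Val L W (L.dfres f) :=
  L.fprec_wf.fix
    (C := fun f => ℕ → (∀ i : Fin (L.dfargs f).length, Val L W ((L.dfargs f).get i)) →
      Val L W (L.dfres f))
    (fun f IH n args =>
      Nat.rec ((E.fbase f).eval IH (baseEnv args))
        (fun y c => (E.fstep f).eval IH (recEnv args y c)) n) f

/-- Evaluation of terms of the schematic language. -/
noncomputable def tmVal (E : Rules L) {W : Srt → Type} {V : Kind → Type}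
    (ρ : ∀ κ, V κ → Val L W κ) {κ : Kind} (t : Term L V κ) : Val L W κ :=
  t.eval (fun f _ => fnVal E f) ρ

/-- A value, seen under one more binder. -/
def weakenVal {W : Srt → Type} (s : Srt) : ∀ κ, Val L W κ → Val L (FOBind W s) κ
  | .arith, n => n
  | .fo _, t => FOTm.rename (fun _ x => .old x) t
  | .seq, X => fun n => FOTm.rename (fun _ x => .old x) (X n)

/-- Values of variables under one more binder. -/
def liftEnv {W : Srt → Type} {V : Kind → Type} (s : Srt) (ρ : ∀ κ, V κ → Val L W κ) :
    ∀ κ, Bind V s κ → Val L (FOBind W s) κ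
  | _, .old x => weakenVal s _ (ρ _ x)
  | _, .new => FOTm.var .new

/-- Evaluation of formulas, for given values of the defined predicate symbols and of the
place-holder `call`. -/
noncomputable def Fm.eval (E : Rules L) {ok : L.DRel → Prop} {hole : Prop}
    (J : ∀ R, ok R → ∀ W : Srt → Type, ℕ →
      (∀ i : Fin (L.drargs R).length, Val L W ((L.drargs R).get i)) → FOFm L W) :
    ∀ {V : Kind → Type} {W : Srt → Type}, (hole → FOFm L W) → (∀ κ, V κ → Val L W κ) →
      Fm L ok hole V → FOFm L W
  | _, _, _, ρ, .rel R args => .rel R (fun i => tmVal E ρ (args i))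
  | _, W, _, ρ, .drel R h t args => J R h W (tmVal E ρ t) (fun i => tmVal E ρ (args i))
  | _, _, c, _, .call h => c h
  | _, _, c, ρ, .neg A => .neg (A.eval E J c ρ)
  | _, _, c, ρ, .and A B => .and (A.eval E J c ρ) (B.eval E J c ρ)
  | _, _, c, ρ, .or A B => .or (A.eval E J c ρ) (B.eval E J c ρ)
  | _, _, c, ρ, .imp A B => .imp (A.eval E J c ρ) (B.eval E J c ρ)
  | _, _, c, ρ, .all s A =>
      .all s (A.eval E J (fun h => (c h).rename fun _ x => .old x) (liftEnv s ρ))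
  | _, _, c, ρ, .ex s A =>
      .ex s (A.eval E J (fun h => (c h).rename fun _ x => .old x) (liftEnv s ρ))

/-- The normal form of `R(n, args)`, for a defined predicate symbol `R`. -/
noncomputable def relVal (E : Rules L) (R : L.DRel) :
    ∀ W : Srt → Type, ℕ → (∀ i : Fin (L.drargs R).length, Val L W ((L.drargs R).get i)) →
      FOFm L W :=
  L.rprec_wf.fix
    (C := fun R => ∀ W : Srt → Type, ℕ →
      (∀ i : Fin (L.drargs R).length, Val L W ((L.drargs R).get i)) → FOFm L W)
    (fun R IH _ n args =>
      Nat.rec ((E.rbase R).eval E IH (fun h => h.elim) (baseEnv args))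
        (fun y c => (E.rstep R).eval E IH (fun _ => c) (stepEnv args y)) n) R

/-- Evaluation of formulas of the schematic language. -/
noncomputable def fmVal (E : Rules L) {V : Kind → Type} {W : Srt → Type}
    (ρ : ∀ κ, V κ → Val L W κ) (A : Form L V) : FOFm L W :=
  A.eval E (fun R _ => relVal E R) (fun h => h.elim) ρ

end Evaluation

/-! ### Schematic proofs -/

/-- The variables of the proofs `π` (for `b = false`) and `ν(k)` (for `b = true`) of a proof
symbol with formal arguments of kinds `ps`: the parameter `k` in the second case only, the formal
arguments `xᵢ`, and countably many free variables of each sort and variable function symbols. -/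
inductive PVar : Bool → List Kind → Kind → Type
  | k {ps : List Kind} : PVar true ps .arith
  | arg {b : Bool} {ps : List Kind} (i : Fin ps.length) : PVar b ps (ps.get i)
  | fv {b : Bool} {ps : List Kind} (s : Srt) (i : ℕ) : PVar b ps (.fo s)
  | sv {b : Bool} {ps : List Kind} (X : ℕ) : PVar b ps .seq

/-- At most the parameter `k`. -/
inductive KVar : Bool → Kind → Type
  | k : KVar true .arith

/-- The end-sequent `S(n, x₁, …, x_α)` of a proof symbol; the parameter `n` is the variable
`PVar.k`.  It is the only arithmetic variable. -/
structure EndSeq (L : Sym) : Type 1 where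
  params : List Kind
  no_arith : Kind.arith ∉ params
  ant : List (Form L (PVar true params))
  suc : List (Form L (PVar true params))

section Proofs

variable {L : Sym}

/-- The substitution of `a` for the parameter and of `args` for the formal arguments. -/
def paramSub {b : Bool} {ps qs : List Kind} (a : Term L (PVar b qs) .arith)
    (args : ∀ i : Fin ps.length, Term L (PVar b qs) (ps.get i)) :
    ∀ κ, PVar true ps κ → Term L (PVar b qs) κ
  | _, .k => a
  | _, .arg i => args i
  | _, .fv s i => .var (.fv s i)
  | _, .sv X => .var (.sv X)

/-- Terms containing at most the parameter, as terms of a proof. -/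
def ofKVar {b : Bool} {ps : List Kind} : ∀ κ, KVar b κ → Term L (PVar b ps) κ
  | _, .k => .var .k

variable {N : ℕ}

/-- Proof links in the proofs of the proof symbol `β`: in `ν(k)`, links `ψ_β(k, args)`; and, in both
proofs, `k`-proof links `ψ_γ(a, args)` with `β < γ`. -/
inductive PLink (S : Fin N → EndSeq L) (β : Fin N) : Bool → Type
  | self (args : ∀ i : Fin (S β).params.length,
      Term L (PVar true (S β).params) ((S β).params.get i)) : PLink S β true
  | later {b : Bool} (γ : Fin N) (h : β < γ) (a : Term L (KVar b) .arith)
      (args : ∀ i : Fin (S γ).params.length,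
        Term L (PVar b (S β).params) ((S γ).params.get i)) : PLink S β b

/-- Antecedent of the sequent of a proof link. -/
def PLink.ant {S : Fin N → EndSeq L} {β : Fin N} :
    ∀ {b : Bool}, PLink S β b → List (Form L (PVar b (S β).params))
  | _, .self args => (S β).ant.map (subst (paramSub (.var .k) args))
  | _, .later γ _ a args =>
      (S γ).ant.map (subst (paramSub (a.subst (fun _ h => h) ofKVar) args))

/-- Succedent of the sequent of a proof link. -/
def PLink.suc {S : Fin N → EndSeq L} {β : Fin N} :
    ∀ {b : Bool}, PLink S β b → List (Form L (PVar b (S β).params))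
  | _, .self args => (S β).suc.map (subst (paramSub (.var .k) args))
  | _, .later γ _ a args =>
      (S γ).suc.map (subst (paramSub (a.subst (fun _ h => h) ofKVar) args))

/-- Eigenvariables: free variables, or schematic variables `X(t)`. -/
inductive Eigen (L : Sym) (b : Bool) (ps : List Kind) : Srt → Type
  | fv (s : Srt) (i : ℕ) : Eigen L b ps s
  | sv (X : ℕ) (t : Term L (PVar b ps) .arith) : Eigen L b ps .iota

/-- An eigenvariable as a term. -/
def Eigen.toTerm {b : Bool} {ps : List Kind} :
    ∀ {s : Srt}, Eigen L b ps s → Term L (PVar b ps) (.fo s)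
  | _, .fv s i => .var (.fv s i)
  | _, .sv X t => .app (.var (.sv X)) t

/-- Exchange of the members number `i` and `i + 1` of a list. -/
def swapAt {α : Type*} : ℕ → List α → List α
  | 0, a :: b :: l => b :: a :: l
  | i + 1, a :: l => a :: swapAt i l
  | _, l => l

/-- The sequent calculus with proof links and the rule for the equational theory.  Sequents are
given by lists; the exchange rules make them multisets of formula occurrences.  The principal and
auxiliary formulas stand at the head of the lists. -/
inductive LKS (E : Rules L) (S : Fin N → EndSeq L) (β : Fin N) (b : Bool) :
    List (Form L (PVar b (S β).params)) → List (Form L (PVar b (S β).params)) → Type 1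
  | ax (A : Form L (PVar b (S β).params)) (hA : A.IsAtom) : LKS E S β b [A] [A]
  | link (l : PLink S β b) : LKS E S β b l.ant l.suc
  | exL {Γ Δ} (i : ℕ) (p : LKS E S β b Γ Δ) : LKS E S β b (swapAt i Γ) Δ
  | exR {Γ Δ} (i : ℕ) (p : LKS E S β b Γ Δ) : LKS E S β b Γ (swapAt i Δ)
  | negL {Γ Δ A} (p : LKS E S β b Γ (A :: Δ)) : LKS E S β b (.neg A :: Γ) Δ
  | negR {Γ Δ A} (p : LKS E S β b (A :: Γ) Δ) : LKS E S β b Γ (.neg A :: Δ)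
  | andL1 {Γ Δ A} (B : Form L (PVar b (S β).params)) (p : LKS E S β b (A :: Γ) Δ) :
      LKS E S β b (.and A B :: Γ) Δ
  | andL2 {Γ Δ B} (A : Form L (PVar b (S β).params)) (p : LKS E S β b (B :: Γ) Δ) :
      LKS E S β b (.and A B :: Γ) Δ
  | andR {Γ Δ Γ' Δ' A B} (p : LKS E S β b Γ (A :: Δ)) (q : LKS E S β b Γ' (B :: Δ')) :
      LKS E S β b (Γ ++ Γ') (.and A B :: (Δ ++ Δ'))
  | orL {Γ Δ Γ' Δ' A B} (p : LKS E S β b (A :: Γ) Δ) (q : LKS E S β b (B :: Γ') Δ') :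
      LKS E S β b (.or A B :: (Γ ++ Γ')) (Δ ++ Δ')
  | orR1 {Γ Δ A} (B : Form L (PVar b (S β).params)) (p : LKS E S β b Γ (A :: Δ)) :
      LKS E S β b Γ (.or A B :: Δ)
  | orR2 {Γ Δ B} (A : Form L (PVar b (S β).params)) (p : LKS E S β b Γ (B :: Δ)) :
      LKS E S β b Γ (.or A B :: Δ)
  | impL {Γ Δ Γ' Δ' A B} (p : LKS E S β b Γ (A :: Δ)) (q : LKS E S β b (B :: Γ') Δ') :
      LKS E S β b (.imp A B :: (Γ ++ Γ')) (Δ ++ Δ')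
  | impR {Γ Δ A B} (p : LKS E S β b (A :: Γ) (B :: Δ)) : LKS E S β b Γ (.imp A B :: Δ)
  | allL {Γ Δ s} (A : Form L (Bind (PVar b (S β).params) s))
      (t : Term L (PVar b (S β).params) (.fo s))
      (p : LKS E S β b (instantiate A t :: Γ) Δ) : LKS E S β b (.all s A :: Γ) Δ
  | allR {Γ Δ s} (A : Form L (Bind (PVar b (S β).params) s)) (e : Eigen L b (S β).params s)
      (hA : ¬ Fm.Occ e.toTerm (.all s A)) (hΓ : ∀ B ∈ Γ, ¬ Fm.Occ e.toTerm B)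
      (hΔ : ∀ B ∈ Δ, ¬ Fm.Occ e.toTerm B)
      (p : LKS E S β b Γ (instantiate A e.toTerm :: Δ)) : LKS E S β b Γ (.all s A :: Δ)
  | exL_quant {Γ Δ s} (A : Form L (Bind (PVar b (S β).params) s)) (e : Eigen L b (S β).params s)
      (hA : ¬ Fm.Occ e.toTerm (.ex s A)) (hΓ : ∀ B ∈ Γ, ¬ Fm.Occ e.toTerm B)
      (hΔ : ∀ B ∈ Δ, ¬ Fm.Occ e.toTerm B)
      (p : LKS E S β b (instantiate A e.toTerm :: Γ) Δ) : LKS E S β b (.ex s A :: Γ) Δ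
  | exR_quant {Γ Δ s} (A : Form L (Bind (PVar b (S β).params) s))
      (t : Term L (PVar b (S β).params) (.fo s))
      (p : LKS E S β b Γ (instantiate A t :: Δ)) : LKS E S β b Γ (.ex s A :: Δ)
  | weakL {Γ Δ} (A : Form L (PVar b (S β).params)) (p : LKS E S β b Γ Δ) : LKS E S β b (A :: Γ) Δ
  | weakR {Γ Δ} (A : Form L (PVar b (S β).params)) (p : LKS E S β b Γ Δ) : LKS E S β b Γ (A :: Δ)
  | contrL {Γ Δ A} (p : LKS E S β b (A :: A :: Γ) Δ) : LKS E S β b (A :: Γ) Δ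
  | contrR {Γ Δ A} (p : LKS E S β b Γ (A :: A :: Δ)) : LKS E S β b Γ (A :: Δ)
  | cut {Γ Δ Γ' Δ' A} (p : LKS E S β b Γ (A :: Δ)) (q : LKS E S β b (A :: Γ') Δ') :
      LKS E S β b (Γ ++ Γ') (Δ ++ Δ')
  | eqL {Γ Δ A A'} (h : FmEq E A A') (p : LKS E S β b (A :: Γ) Δ) : LKS E S β b (A' :: Γ) Δ
  | eqR {Γ Δ A A'} (h : FmEq E A A') (p : LKS E S β b Γ (A :: Δ)) : LKS E S β b Γ (A' :: Δ)

/-- A proof schema `⟨(π₁, ν₁(k)), …, (π_α, ν_α(k))⟩` with `α = N + 1` proof symbols: `base β` is a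
proof of `S_β(0, x̄)` and `step β` is a proof of `S_β(k+1, x̄)`. -/
structure ProofSchema (E : Rules L) (N : ℕ) : Type 1 where
  S : Fin (N + 1) → EndSeq L
  base : ∀ β, LKS E S β false
    ((S β).ant.map (subst (paramSub .azero fun i => .var (.arg i))))
    ((S β).suc.map (subst (paramSub .azero fun i => .var (.arg i))))
  step : ∀ β, LKS E S β true
    ((S β).ant.map (subst (paramSub (.asucc (.var .k)) fun i => .var (.arg i))))
    ((S β).suc.map (subst (paramSub (.asucc (.var .k)) fun i => .var (.arg i))))

/-! ### Characteristic terms -/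

/-- Clause-set terms; `cl l Ωl Ωr` is the clause-set symbol `cl^{ψ,Ω}(a, args)`, where
`l` is the proof link `ψ(a, args)`, and the configuration `Ω` is given by the lists `Ωl`, `Ωr` telling
which occurrences of the two sides of the sequent belong to it. -/
inductive ClTerm (S : Fin N → EndSeq L) (β : Fin N) (b : Bool) : Type 1
  | clause (Γ Δ : List (Form L (PVar b (S β).params))) : ClTerm S β b
  | cl (l : PLink S β b) (Ωl Ωr : List Bool) : ClTerm S β b
  | plus (t t' : ClTerm S β b) : ClTerm S β b
  | times (t t' : ClTerm S β b) : ClTerm S β b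

/-- The sublist of the marked members. -/
def marked {α : Type*} : List Bool → List α → List α
  | true :: m, a :: l => a :: marked m l
  | false :: m, _ :: l => marked m l
  | _, _ => []

/-- `⊕` for a binary inference on marked, `⊗` for one on unmarked formulas. -/
def ClTerm.join {S : Fin N → EndSeq L} {β : Fin N} {b : Bool} (mark : Bool)
    (t t' : ClTerm S β b) : ClTerm S β b :=
  bif mark then .plus t t' else .times t t'

/-- The characteristic term `Θ(π, Ω)`.  The lists `m`, `m'` mark, in the antecedent and in the
succedent of the end-sequent, the occurrences that are `Ω`- or cut-ancestors; the recursion passes the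
marks from the conclusion of each inference to the ancestors in its premises. -/
def LKS.charTerm {E : Rules L} {S : Fin N → EndSeq L} {β : Fin N} {b : Bool} :
    ∀ {Γ Δ : List (Form L (PVar b (S β).params))}, LKS E S β b Γ Δ →
      List Bool → List Bool → ClTerm S β b
  | _, _, .ax A _, m, m' => .clause (marked m [A]) (marked m' [A])
  | _, _, .link l, m, m' => .cl l m m'
  | _, _, .exL i p, m, m' => p.charTerm (swapAt i m) m'
  | _, _, .exR i p, m, m' => p.charTerm m (swapAt i m')
  | _, _, .negL p, m, m' => p.charTerm m.tail (m.headD false :: m')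
  | _, _, .negR p, m, m' => p.charTerm (m'.headD false :: m) m'.tail
  | _, _, .andL1 _ p, m, m' => p.charTerm m m'
  | _, _, .andL2 _ p, m, m' => p.charTerm m m'
  | _, _, .andR (Γ := Γ) (Δ := Δ) p q, m, m' =>
      .join (m'.headD false)
        (p.charTerm (m.take Γ.length) (m'.headD false :: m'.tail.take Δ.length))
        (q.charTerm (m.drop Γ.length) (m'.headD false :: m'.tail.drop Δ.length))
  | _, _, .orL (Γ := Γ) (Δ := Δ) p q, m, m' =>
      .join (m.headD false)
        (p.charTerm (m.headD false :: m.tail.take Γ.length) (m'.take Δ.length))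
        (q.charTerm (m.headD false :: m.tail.drop Γ.length) (m'.drop Δ.length))
  | _, _, .orR1 _ p, m, m' => p.charTerm m m'
  | _, _, .orR2 _ p, m, m' => p.charTerm m m'
  | _, _, .impL (Γ := Γ) (Δ := Δ) p q, m, m' =>
      .join (m.headD false)
        (p.charTerm (m.tail.take Γ.length) (m.headD false :: m'.take Δ.length))
        (q.charTerm (m.headD false :: m.tail.drop Γ.length) (m'.drop Δ.length))
  | _, _, .impR p, m, m' => p.charTerm (m'.headD false :: m) m'
  | _, _, .allL _ _ p, m, m' => p.charTerm m m'
  | _, _, .allR _ _ _ _ _ p, m, m' => p.charTerm m m'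
  | _, _, .exL_quant _ _ _ _ _ p, m, m' => p.charTerm m m'
  | _, _, .exR_quant _ _ p, m, m' => p.charTerm m m'
  | _, _, .weakL _ p, m, m' => p.charTerm m.tail m'
  | _, _, .weakR _ p, m, m' => p.charTerm m m'.tail
  | _, _, .contrL p, m, m' => p.charTerm (m.headD false :: m) m'
  | _, _, .contrR p, m, m' => p.charTerm m (m'.headD false :: m')
  | _, _, .cut (Γ := Γ) (Δ := Δ) p q, m, m' =>
      .join true
        (p.charTerm (m.take Γ.length) (true :: m'.take Δ.length))
        (q.charTerm (true :: m.drop Γ.length) (m'.drop Δ.length))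
  | _, _, .eqL _ p, m, m' => p.charTerm m m'
  | _, _, .eqR _ p, m, m' => p.charTerm m m'

/-! ### Evaluation of proof schemata and of schematic characteristic terms -/

/-- Normal clause-set terms. -/
inductive NClTerm (L : Sym) : Type 1
  | clause (C : FOSeq L) : NClTerm L
  | plus (t t' : NClTerm L) : NClTerm L
  | times (t t' : NClTerm L) : NClTerm L

/-- The set `|t|` of clauses denoted by a normal clause-set term. -/
def NClTerm.clauses : NClTerm L → Set (FOSeq L)
  | .clause C => {C}
  | .plus t t' => t.clauses ∪ t'.clauses
  | .times t t' => {C | ∃ D ∈ t.clauses, ∃ D' ∈ t'.clauses, C = D.merge D'}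

/-- Evaluated (first-order) proofs, as trees of sequents.  A unary inference carries its
eigenvariable, if it has one. -/
inductive PTree (L : Sym) : Type 1
  | leaf (C : FOSeq L) : PTree L
  | unary (C : FOSeq L) (e : Option (Σ s, FOVar s)) (p : PTree L) : PTree L
  | binary (C : FOSeq L) (p q : PTree L) : PTree L

/-- Values of the variables of a proof. -/
abbrev PEnv (L : Sym) (b : Bool) (ps : List Kind) : Type := ∀ κ, PVar b ps κ → Val L FOVar κ

/-- Values of the formal arguments. -/
abbrev Args (L : Sym) (ps : List Kind) : Type := ∀ i : Fin ps.length, Val L FOVar (ps.get i)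

/-- The value `n` for the parameter, and the values `args` for the formal arguments. -/
def paramEnv {ps : List Kind} (b : Bool) (n : ℕ) (args : Args L ps) : PEnv L b ps
  | _, .k => n
  | _, .arg i => args i
  | _, .fv s i => FOTm.var (.fv s i)
  | _, .sv X => fun n => FOTm.var (.sv X n)

/-- The value `n` for the parameter. -/
def kEnv (b : Bool) (n : ℕ) : ∀ κ, KVar b κ → Val L FOVar κ
  | _, .k => n

/-- Evaluation of sequents. -/
noncomputable def evalSeq (E : Rules L) {b : Bool} {ps : List Kind} (ρ : PEnv L b ps)
    (Γ Δ : List (Form L (PVar b ps))) : FOSeq L :=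
  ⟨((Γ.map (fmVal E ρ) : List _) : Multiset _), ((Δ.map (fmVal E ρ) : List _) : Multiset _)⟩

/-- The first-order variable denoted by an eigenvariable. -/
noncomputable def Eigen.eval (E : Rules L) {b : Bool} {ps : List Kind} (ρ : PEnv L b ps) :
    ∀ {s : Srt}, Eigen L b ps s → Σ s, FOVar s
  | _, .fv s i => ⟨s, .fv s i⟩
  | _, .sv X t => ⟨.iota, .sv X (tmVal E ρ t)⟩

/-- Evaluation of clause-set terms, where `J` gives the values of the clause-set symbols. -/
noncomputable def ClTerm.eval (E : Rules L) {S : Fin N → EndSeq L} {β : Fin N} {b : Bool}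
    (J : PLink S β b → List Bool → List Bool → NClTerm L) (ρ : PEnv L b (S β).params) :
    ClTerm S β b → NClTerm L
  | .clause Γ Δ => .clause (evalSeq E ρ Γ Δ)
  | .cl l m m' => J l m m'
  | .plus t t' => .plus (t.eval E J ρ) (t'.eval E J ρ)
  | .times t t' => .times (t.eval E J ρ) (t'.eval E J ρ)

/-- The evaluated end-sequent of a proof. -/
noncomputable def LKS.root {E : Rules L} {S : Fin N → EndSeq L} {β : Fin N} {b : Bool}
    {Γ Δ : List (Form L (PVar b (S β).params))} (_ : LKS E S β b Γ Δ)
    (ρ : PEnv L b (S β).params) : FOSeq L :=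
  evalSeq E ρ Γ Δ

/-- Evaluation of proofs, where `J` gives the proofs replacing the proof links. -/
noncomputable def LKS.tree {E : Rules L} {S : Fin N → EndSeq L} {β : Fin N} {b : Bool}
    (J : PLink S β b → PTree L) (ρ : PEnv L b (S β).params) :
    ∀ {Γ Δ : List (Form L (PVar b (S β).params))}, LKS E S β b Γ Δ → PTree L
  | _, _, r@(.ax _ _) => .leaf (r.root ρ)
  | _, _, .link l => J l
  | _, _, r@(.exL _ p) => .unary (r.root ρ) none (p.tree J ρ)
  | _, _, r@(.exR _ p) => .unary (r.root ρ) none (p.tree J ρ)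
  | _, _, r@(.negL p) => .unary (r.root ρ) none (p.tree J ρ)
  | _, _, r@(.negR p) => .unary (r.root ρ) none (p.tree J ρ)
  | _, _, r@(.andL1 _ p) => .unary (r.root ρ) none (p.tree J ρ)
  | _, _, r@(.andL2 _ p) => .unary (r.root ρ) none (p.tree J ρ)
  | _, _, r@(.andR p q) => .binary (r.root ρ) (p.tree J ρ) (q.tree J ρ)
  | _, _, r@(.orL p q) => .binary (r.root ρ) (p.tree J ρ) (q.tree J ρ)
  | _, _, r@(.orR1 _ p) => .unary (r.root ρ) none (p.tree J ρ)
  | _, _, r@(.orR2 _ p) => .unary (r.root ρ) none (p.tree J ρ)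
  | _, _, r@(.impL p q) => .binary (r.root ρ) (p.tree J ρ) (q.tree J ρ)
  | _, _, r@(.impR p) => .unary (r.root ρ) none (p.tree J ρ)
  | _, _, r@(.allL _ _ p) => .unary (r.root ρ) none (p.tree J ρ)
  | _, _, r@(.allR _ e _ _ _ p) => .unary (r.root ρ) (some (e.eval E ρ)) (p.tree J ρ)
  | _, _, r@(.exL_quant _ e _ _ _ p) => .unary (r.root ρ) (some (e.eval E ρ)) (p.tree J ρ)
  | _, _, r@(.exR_quant _ _ p) => .unary (r.root ρ) none (p.tree J ρ)
  | _, _, r@(.weakL _ p) => .unary (r.root ρ) none (p.tree J ρ)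
  | _, _, r@(.weakR _ p) => .unary (r.root ρ) none (p.tree J ρ)
  | _, _, r@(.contrL p) => .unary (r.root ρ) none (p.tree J ρ)
  | _, _, r@(.contrR p) => .unary (r.root ρ) none (p.tree J ρ)
  | _, _, r@(.cut p q) => .binary (r.root ρ) (p.tree J ρ) (q.tree J ρ)
  | _, _, r@(.eqL _ p) => .unary (r.root ρ) none (p.tree J ρ)
  | _, _, r@(.eqR _ p) => .unary (r.root ρ) none (p.tree J ρ)

/-- The value of a proof link, given the values `prev` of the links to the proof symbol itself and
`rest` of the links to the later ones. -/
noncomputable def PLink.value (E : Rules L) {S : Fin N → EndSeq L} {β : Fin N} {X : Type 1} :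
    ∀ {b : Bool}, (Args L (S β).params → X) → (∀ γ, β < γ → ℕ → Args L (S γ).params → X) →
      (n : ℕ) → PEnv L b (S β).params → PLink S β b → X
  | _, prev, _, _, ρ, .self args => prev fun i => tmVal E ρ (args i)
  | _, _, rest, n, ρ, .later γ h a args =>
      rest γ h (tmVal E (kEnv _ n) a) fun i => tmVal E ρ (args i)

/-- The clause-set term `cl^{ψ_β,Ω}(n, args)↓`: the normal form with respect to the rules
`cl^{ψ_β,Ω}(0, x̄) → Θ(π_β, Ω)`, `cl^{ψ_β,Ω}(k+1, x̄) → Θ(ν_β(k), Ω)` and those of the defined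
symbols. -/
noncomputable def ProofSchema.clVal {E : Rules L} (Ψ : ProofSchema E N) (β : Fin (N + 1)) :
    ℕ → Args L (Ψ.S β).params → List Bool → List Bool → NClTerm L :=
  (wellFounded_gt (α := Fin (N + 1))).fix
    (C := fun β => ℕ → Args L (Ψ.S β).params → List Bool → List Bool → NClTerm L)
    (fun β IH n =>
      Nat.rec
        (fun args m m' => ((Ψ.base β).charTerm m m').eval E
          (PLink.value E (fun _ _ _ => .clause ⟨0, 0⟩) IH 0 (paramEnv false 0 args))
          (paramEnv false 0 args))
        (fun k prev args m m' => ((Ψ.step β).charTerm m m').eval E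
          (PLink.value E prev IH k (paramEnv true k args)) (paramEnv true k args)) n) β

/-- The proof `ψ_β(n, args)↓`: the normal form with respect to the rules `ψ_β(0, x̄) → π_β`,
`ψ_β(k+1, x̄) → ν_β(k)` for proof links and those of the defined symbols. -/
noncomputable def ProofSchema.treeVal {E : Rules L} (Ψ : ProofSchema E N) (β : Fin (N + 1)) :
    ℕ → Args L (Ψ.S β).params → PTree L :=
  (wellFounded_gt (α := Fin (N + 1))).fix
    (C := fun β => ℕ → Args L (Ψ.S β).params → PTree L)
    (fun β IH n =>
      Nat.rec
        (fun args => (Ψ.base β).tree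
          (PLink.value E (fun _ => .leaf ⟨0, 0⟩) IH 0 (paramEnv false 0 args))
          (paramEnv false 0 args))
        (fun k prev args => (Ψ.step β).tree
          (PLink.value E prev IH k (paramEnv true k args)) (paramEnv true k args)) n) β

/-- The formal arguments of a proof symbol, as first-order variables (there are none of kind
`arith`). -/
def formalVal (i : ℕ) : ∀ κ, Val L FOVar κ
  | .arith => (0 : ℕ)
  | .fo s => FOTm.var (.par s i)
  | .seq => fun n => FOTm.var (.parSeq i n)

/-- The evaluation `Ψ↓γ`. -/
noncomputable def ProofSchema.evalProof {E : Rules L} (Ψ : ProofSchema E N) (γ : ℕ) : PTree L :=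
  Ψ.treeVal 0 γ fun i => formalVal i _

/-- The evaluated schematic characteristic term `Θ(Ψ)↓γ`, for the empty configuration. -/
noncomputable def ProofSchema.charTerm {E : Rules L} (Ψ : ProofSchema E N) (γ : ℕ) : NClTerm L :=
  Ψ.clVal 0 γ (fun i => formalVal i _) ((Ψ.S 0).ant.map fun _ => false)
    ((Ψ.S 0).suc.map fun _ => false)

/-- The evaluated schematic characteristic clause set `CL(Ψ)↓γ`. -/
noncomputable def ProofSchema.CL {E : Rules L} (Ψ : ProofSchema E N) (γ : ℕ) : Set (FOSeq L) :=
  (Ψ.charTerm γ).clauses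

/-! ### Regularity -/

/-- The variable is an eigenvariable of the proof. -/
def PTree.IsEigen : PTree L → (Σ s, FOVar s) → Prop
  | .leaf _, _ => False
  | .unary _ e p, x => e = some x ∨ p.IsEigen x
  | .binary _ p q, x => p.IsEigen x ∨ q.IsEigen x

/-- The variable occurs in a sequent of the proof, or as an eigenvariable. -/
def PTree.Occ : PTree L → (Σ s, FOVar s) → Prop
  | .leaf C, x => C.Occ x.2
  | .unary C e p, x => C.Occ x.2 ∨ e = some x ∨ p.Occ x
  | .binary C p q, x => C.Occ x.2 ∨ p.Occ x ∨ q.Occ x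

/-- Regular proofs: different strong quantifier inferences have different eigenvariables, and the
eigenvariable of an inference occurs only in sequents above the inference. -/
def PTree.IsRegular : PTree L → Prop
  | .leaf _ => True
  | .unary C e p => p.IsRegular ∧ (∀ x, e = some x → ¬ p.IsEigen x) ∧
      ∀ x, (e = some x ∨ p.IsEigen x) → ¬ C.Occ x.2
  | .binary C p q => p.IsRegular ∧ q.IsRegular ∧
      (∀ x, p.IsEigen x → ¬ q.Occ x ∧ ¬ C.Occ x.2) ∧
      ∀ x, q.IsEigen x → ¬ p.Occ x ∧ ¬ C.Occ x.2

/-- Regular proof schemata: all the proofs they represent are regular. -/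
def ProofSchema.IsRegular {E : Rules L} (Ψ : ProofSchema E N) : Prop :=
  ∀ γ : ℕ, (Ψ.evalProof γ).IsRegular

end Proofs

end Ceres

/-!
The proof is a local form of soundness.  Fix a structure `M` and a regular evaluated proof of a
sequent with a configuration `Ω`, and let `S_Ω` be the subsequent of the end-sequent given by the
marked occurrences.  The invariant (`Supports`) is: if all characteristic clauses are true at every
assignment that differs from `v` only on eigenvariables of the proof, then `S_Ω` is true at `v`.  For
`Ω = ∅` the sequent `S_Ω` is empty, so no structure makes all clauses true at all assignments.

The invariant is proved by induction on proofs (`LKS.supports_marked`) and then along the recursion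
of the schema, on the proof symbol and the parameter (`ProofSchema.supports_marked`).

* A binary inference on marked formulas joins the clause sets by `⊕`, and the inference itself is
  sound (`Supports.plus`).
* A binary inference on unmarked formulas takes all merges `C ∘ D`, and only one of the two marked
  subsequents has to be true.  If both fail at `v`, then clauses `C` and `D` fail at two variants of
  `v`.  By regularity the eigenvariables of either subproof do not occur in the other one, hence the
  variants can be glued to an assignment at which `C ∘ D` fails (`Supports.times`).  Since `C` and
  `D` may still share variables that are not eigenvariables, the truth of all merges at all
  assignments does not make one of the two clause sets true at all assignments; this is why the
  invariant is local in `v`.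
* At a strong quantifier inference the eigenvariable, absent from the conclusion by regularity, may
  be given any value (`Supports.unary_eigen`).

Truth of normal forms is never compared syntactically.  Schematic expressions are evaluated directly
in `M` (`Tm.sem`, `Fm.sem`), which agrees with the truth value of the normal form (`holds_fmVal`).
This evaluation commutes with substitution (`fmSem_subst`), which accounts for quantifier inferences
and proof links, and is invariant under the equational theory (`FmEq.fmSem_iff`).
-/

namespace Ceres

/-! ### Evaluation of schematic expressions in a structure -/

section Semantics

variable {L : Sym}

/-- Semantic values: numbers for arithmetic terms (lifted to the universe of the structure), elements
of the domains for terms of the two sorts, sequences of elements for variable function symbols. -/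
def SVal (M : FOStruct.{u} L) : Kind → Type u
  | .arith => ULift ℕ
  | .fo s => M.dom s
  | .seq => ℕ → M.dom .iota

/-- The element denoted by the numeral `sⁿ(0)`. -/
def FOStruct.numeral (M : FOStruct.{u} L) : ℕ → M.dom .omega
  | 0 => M.zero
  | n + 1 => M.succ (M.numeral n)

/-- The semantic value of a syntactic value, under an assignment. -/
def Val.sem (M : FOStruct.{u} L) {W : Srt → Type} (v : ∀ s, W s → M.dom s) :
    ∀ κ, Val L W κ → SVal M κ
  | .arith, n => ULift.up n
  | .fo _, t => FOTm.val M v t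
  | .seq, X => fun n => FOTm.val M v (X n)

/-- Evaluation of terms in a structure, for given values of the defined function symbols. -/
def Tm.sem (M : FOStruct.{u} L) {ok : L.DFn → Prop}
    (I : ∀ f, ok f → ℕ → (∀ i : Fin (L.dfargs f).length, SVal M ((L.dfargs f).get i)) →
      SVal M (L.dfres f))
    {V : Kind → Type} (ρ : ∀ κ, V κ → SVal M κ) : ∀ {κ : Kind}, Tm L ok V κ → SVal M κ
  | _, .var x => ρ _ x
  | _, .app X t => (X.sem M I ρ : ℕ → M.dom .iota) (ULift.down (t.sem M I ρ : ULift ℕ))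
  | _, .azero => (ULift.up 0 : ULift ℕ)
  | _, .asucc t => (ULift.up (ULift.down (t.sem M I ρ : ULift ℕ) + 1) : ULift ℕ)
  | _, .num t => M.numeral (ULift.down (t.sem M I ρ : ULift ℕ))
  | _, .succ t => M.succ (t.sem M I ρ)
  | _, .fn f args => M.fn f (fun i => (args i).sem M I ρ)
  | _, .dfn f h t args =>
      I f h (ULift.down (t.sem M I ρ : ULift ℕ)) (fun i => (args i).sem M I ρ)

/-- Semantic values of the variables of a base rule. -/
def baseSEnv {M : FOStruct.{u} L} {ps : List Kind} (args : ∀ i : Fin ps.length, SVal M (ps.get i)) :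
    ∀ κ, BaseVar ps κ → SVal M κ
  | _, .arg i => args i

/-- Semantic values of the variables of a step rule of a predicate symbol. -/
def stepSEnv {M : FOStruct.{u} L} {ps : List Kind} (args : ∀ i : Fin ps.length, SVal M (ps.get i))
    (y : ℕ) : ∀ κ, StepVar ps κ → SVal M κ
  | _, .arg i => args i
  | _, .pred => (ULift.up y : ULift ℕ)

/-- Semantic values of the variables of a step rule and of the recursive call. -/
def recSEnv {M : FOStruct.{u} L} {ps : List Kind} {r : Kind}
    (args : ∀ i : Fin ps.length, SVal M (ps.get i)) (y : ℕ) (c : SVal M r) :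
    ∀ κ, RecVar ps r κ → SVal M κ
  | _, .arg i => args i
  | _, .pred => (ULift.up y : ULift ℕ)
  | _, .call => c

/-- The function on semantic values defined by the rewrite rules of `f`. -/
noncomputable def fnSem (E : Rules L) (M : FOStruct.{u} L) (f : L.DFn) :
    ℕ → (∀ i : Fin (L.dfargs f).length, SVal M ((L.dfargs f).get i)) → SVal M (L.dfres f) :=
  L.fprec_wf.fix
    (C := fun f => ℕ → (∀ i : Fin (L.dfargs f).length, SVal M ((L.dfargs f).get i)) →
      SVal M (L.dfres f))
    (fun f IH n args =>
      Nat.rec ((E.fbase f).sem M IH (baseSEnv args))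
        (fun y c => (E.fstep f).sem M IH (recSEnv args y c)) n) f

/-- Evaluation of terms of the schematic language in a structure. -/
noncomputable def tmSem (E : Rules L) (M : FOStruct.{u} L) {V : Kind → Type}
    (ρ : ∀ κ, V κ → SVal M κ) {κ : Kind} (t : Term L V κ) : SVal M κ :=
  t.sem M (fun f _ => fnSem E M f) ρ

/-- Semantic environments extended by the value `d` of the newest variable. -/
def extendSEnv {M : FOStruct.{u} L} {V : Kind → Type} {s : Srt} (ρ : ∀ κ, V κ → SVal M κ)
    (d : M.dom s) : ∀ κ, Bind V s κ → SVal M κ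
  | _, .old x => ρ _ x
  | _, .new => d

/-- Truth of formulas in a structure, for given values of the defined predicate symbols and of the
place-holder `call`. -/
def Fm.sem (E : Rules L) (M : FOStruct.{u} L) {ok : L.DRel → Prop} {hole : Prop}
    (J : ∀ R, ok R → ℕ → (∀ i : Fin (L.drargs R).length, SVal M ((L.drargs R).get i)) → Prop)
    (c : hole → Prop) :
    ∀ {V : Kind → Type}, (∀ κ, V κ → SVal M κ) → Fm L ok hole V → Prop
  | _, ρ, .rel R args => M.rel R (fun i => tmSem E M ρ (args i))
  | _, ρ, .drel R h t args =>
      J R h (ULift.down (tmSem E M ρ t : ULift ℕ)) (fun i => tmSem E M ρ (args i))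
  | _, _, .call h => c h
  | _, ρ, .neg A => ¬ A.sem E M J c ρ
  | _, ρ, .and A B => A.sem E M J c ρ ∧ B.sem E M J c ρ
  | _, ρ, .or A B => A.sem E M J c ρ ∨ B.sem E M J c ρ
  | _, ρ, .imp A B => A.sem E M J c ρ → B.sem E M J c ρ
  | _, ρ, .all _ A => ∀ d, A.sem E M J c (extendSEnv ρ d)
  | _, ρ, .ex _ A => ∃ d, A.sem E M J c (extendSEnv ρ d)

/-- The predicate on semantic values defined by the rewrite rules of `R`. -/
noncomputable def relSem (E : Rules L) (M : FOStruct.{u} L) (R : L.DRel) :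
    ℕ → (∀ i : Fin (L.drargs R).length, SVal M ((L.drargs R).get i)) → Prop :=
  L.rprec_wf.fix
    (C := fun R => ℕ → (∀ i : Fin (L.drargs R).length, SVal M ((L.drargs R).get i)) → Prop)
    (fun R IH n args =>
      Nat.rec ((E.rbase R).sem E M IH (fun h => h.elim) (baseSEnv args))
        (fun y c => (E.rstep R).sem E M IH (fun _ => c) (stepSEnv args y)) n) R

/-- Truth of formulas of the schematic language in a structure. -/
noncomputable def fmSem (E : Rules L) (M : FOStruct.{u} L) {V : Kind → Type}
    (ρ : ∀ κ, V κ → SVal M κ) (A : Form L V) : Prop :=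
  A.sem E M (fun R _ => relSem E M R) (fun h => h.elim) ρ

/-! ### The recursion equations -/

theorem fnVal_zero (E : Rules L) {W : Srt → Type} (f : L.DFn)
    (args : ∀ i : Fin (L.dfargs f).length, Val L W ((L.dfargs f).get i)) :
    fnVal E f 0 args = (E.fbase f).eval (fun g _ => fnVal E g) (baseEnv args) := by
  rw [fnVal, L.fprec_wf.fix_eq]; rfl

theorem fnVal_succ (E : Rules L) {W : Srt → Type} (f : L.DFn) (n : ℕ)
    (args : ∀ i : Fin (L.dfargs f).length, Val L W ((L.dfargs f).get i)) :
    fnVal E f (n + 1) args =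
      (E.fstep f).eval (fun g _ => fnVal E g) (recEnv args n (fnVal E f n args)) := by
  have h : ∀ n, fnVal E f n args = _ := fun n => by rw [fnVal, L.fprec_wf.fix_eq]
  rw [h (n + 1), h n]; rfl

theorem fnSem_zero (E : Rules L) (M : FOStruct.{u} L) (f : L.DFn)
    (args : ∀ i : Fin (L.dfargs f).length, SVal M ((L.dfargs f).get i)) :
    fnSem E M f 0 args = (E.fbase f).sem M (fun g _ => fnSem E M g) (baseSEnv args) := by
  rw [fnSem, L.fprec_wf.fix_eq]; rfl

theorem fnSem_succ (E : Rules L) (M : FOStruct.{u} L) (f : L.DFn) (n : ℕ)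
    (args : ∀ i : Fin (L.dfargs f).length, SVal M ((L.dfargs f).get i)) :
    fnSem E M f (n + 1) args =
      (E.fstep f).sem M (fun g _ => fnSem E M g) (recSEnv args n (fnSem E M f n args)) := by
  have h : ∀ n, fnSem E M f n args = _ := fun n => by rw [fnSem, L.fprec_wf.fix_eq]
  rw [h (n + 1), h n]; rfl

theorem relVal_zero (E : Rules L) (W : Srt → Type) (R : L.DRel)
    (args : ∀ i : Fin (L.drargs R).length, Val L W ((L.drargs R).get i)) :
    relVal E R W 0 args =
      (E.rbase R).eval E (fun Q _ => relVal E Q) (fun h => h.elim) (baseEnv args) := by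
  rw [relVal, L.rprec_wf.fix_eq]; rfl

theorem relVal_succ (E : Rules L) (W : Srt → Type) (R : L.DRel) (n : ℕ)
    (args : ∀ i : Fin (L.drargs R).length, Val L W ((L.drargs R).get i)) :
    relVal E R W (n + 1) args = (E.rstep R).eval E (fun Q _ => relVal E Q)
      (fun _ => relVal E R W n args) (stepEnv args n) := by
  have h : ∀ n, relVal E R W n args = _ := fun n => by rw [relVal, L.rprec_wf.fix_eq]
  rw [h (n + 1), h n]; rfl

theorem relSem_zero (E : Rules L) (M : FOStruct.{u} L) (R : L.DRel)
    (args : ∀ i : Fin (L.drargs R).length, SVal M ((L.drargs R).get i)) :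
    relSem E M R 0 args ↔
      (E.rbase R).sem E M (fun Q _ => relSem E M Q) (fun h => h.elim) (baseSEnv args) := by
  rw [relSem, L.rprec_wf.fix_eq]; rfl

theorem relSem_succ (E : Rules L) (M : FOStruct.{u} L) (R : L.DRel) (n : ℕ)
    (args : ∀ i : Fin (L.drargs R).length, SVal M ((L.drargs R).get i)) :
    relSem E M R (n + 1) args ↔ (E.rstep R).sem E M (fun Q _ => relSem E M Q)
      (fun _ => relSem E M R n args) (stepSEnv args n) := by
  have h : ∀ n, relSem E M R n args = _ := fun n => by rw [relSem, L.rprec_wf.fix_eq]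
  rw [h (n + 1), h n]; rfl

/-! ### Normal forms have the semantic value of the schematic expression -/

theorem val_numeral (M : FOStruct.{u} L) {W : Srt → Type} (v : ∀ s, W s → M.dom s) (n : ℕ) :
    (numeral n : FOTm L W .omega).val M v = M.numeral n := by
  induction n with
  | zero => rfl
  | succ n ih => simp only [numeral, FOTm.val, FOStruct.numeral, ih]

theorem Tm.sem_eval (M : FOStruct.{u} L) {ok : L.DFn → Prop} {W : Srt → Type}
    (v : ∀ s, W s → M.dom s)
    {I : ∀ f, ok f → ℕ → (∀ i : Fin (L.dfargs f).length, Val L W ((L.dfargs f).get i)) →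
      Val L W (L.dfres f)}
    {I' : ∀ f, ok f → ℕ → (∀ i : Fin (L.dfargs f).length, SVal M ((L.dfargs f).get i)) →
      SVal M (L.dfres f)}
    (hI : ∀ f h n args, Val.sem M v _ (I f h n args) = I' f h n fun i => Val.sem M v _ (args i))
    {V : Kind → Type} (ρ : ∀ κ, V κ → Val L W κ) {κ : Kind} (t : Tm L ok V κ) :
    Val.sem M v _ (t.eval I ρ) = t.sem M I' fun κ x => Val.sem M v κ (ρ κ x) := by
  induction t with
  | var x => rfl
  | app X t ihX iht =>
    simp only [Tm.sem, Tm.eval, ← ihX, ← iht]; rfl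
  | azero => rfl
  | asucc t ih => simp only [Tm.sem, Tm.eval, ← ih]; rfl
  | num t ih => simp only [Tm.sem, Tm.eval, ← ih]; exact val_numeral M v _
  | succ t ih => simp only [Tm.sem, Tm.eval, ← ih]; rfl
  | fn f args ih => simp only [Tm.sem, Tm.eval, ← ih]; rfl
  | dfn f h t args iht ih => simp only [Tm.sem, Tm.eval, ← ih, ← iht]; exact hI _ _ _ _

theorem sem_fnVal (E : Rules L) (M : FOStruct.{u} L) {W : Srt → Type} (v : ∀ s, W s → M.dom s)
    (f : L.DFn) (n : ℕ) (args : ∀ i : Fin (L.dfargs f).length, Val L W ((L.dfargs f).get i)) :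
    Val.sem M v _ (fnVal E f n args) = fnSem E M f n fun i => Val.sem M v _ (args i) := by
  induction f using L.fprec_wf.induction generalizing n with
  | _ f IH =>
    induction n with
    | zero =>
      rw [fnVal_zero, fnSem_zero, Tm.sem_eval M v (fun g hg n args => IH g hg n args)]
      congr 1; funext κ x; cases x; rfl
    | succ n ih =>
      rw [fnVal_succ, fnSem_succ, Tm.sem_eval M v (fun g hg n args => IH g hg n args)]
      congr 1; funext κ x
      cases x with
      | arg i => rfl
      | pred => rfl
      | call => exact ih

theorem sem_tmVal (E : Rules L) (M : FOStruct.{u} L) {W : Srt → Type} (v : ∀ s, W s → M.dom s)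
    {V : Kind → Type} (ρ : ∀ κ, V κ → Val L W κ) {κ : Kind} (t : Term L V κ) :
    Val.sem M v _ (tmVal E ρ t) = tmSem E M (fun κ x => Val.sem M v κ (ρ κ x)) t :=
  Tm.sem_eval M v (fun f _ n args => sem_fnVal E M v f n args) ρ t

theorem FOTm.val_rename (M : FOStruct.{u} L) {W W' : Srt → Type} (r : ∀ s, W s → W' s)
    (v : ∀ s, W' s → M.dom s) {s : Srt} (t : FOTm L W s) :
    (t.rename r).val M v = t.val M fun s x => v s (r s x) := by
  induction t with
  | var x => rfl
  | zero => rfl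
  | succ t ih => simp only [rename, val, ih]
  | fn f args ih => simp only [rename, val, ih]

theorem FOFm.holds_rename (M : FOStruct.{u} L) {W W' : Srt → Type} (r : ∀ s, W s → W' s)
    (v : ∀ s, W' s → M.dom s) (A : FOFm L W) :
    (A.rename r).Holds M v ↔ A.Holds M fun s x => v s (r s x) := by
  have key : ∀ {W W' : Srt → Type} (r : ∀ s, W s → W' s) (v : ∀ s, W' s → M.dom s) (s : Srt)
      (d : M.dom s), (fun s' x => extend M v d s' (liftFORen s r s' x)) =
        extend M (fun s' x => v s' (r s' x)) d := by
    intro W W' r v s d; funext s' x; cases x <;> rfl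
  induction A generalizing W' with
  | rel R args => simp only [rename, Holds, FOTm.val_rename]
  | neg A ih => simp only [rename, Holds, ih]
  | and A B ihA ihB => simp only [rename, Holds, ihA, ihB]
  | or A B ihA ihB => simp only [rename, Holds, ihA, ihB]
  | imp A B ihA ihB => simp only [rename, Holds, ihA, ihB]
  | all s A ih => simp only [rename, Holds, ih, key]
  | ex s A ih => simp only [rename, Holds, ih, key]

theorem sem_liftEnv (M : FOStruct.{u} L) {W : Srt → Type} (v : ∀ s, W s → M.dom s)
    {V : Kind → Type} (ρ : ∀ κ, V κ → Val L W κ) {s : Srt} (d : M.dom s) :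
    (fun κ x => Val.sem M (extend M v d) κ (liftEnv s ρ κ x)) =
      extendSEnv (fun κ x => Val.sem M v κ (ρ κ x)) d := by
  funext κ x
  cases x with
  | old x =>
    cases κ with
    | arith => rfl
    | fo s' => exact FOTm.val_rename M _ _ _
    | seq => funext n; exact FOTm.val_rename M _ _ _
  | new => rfl

theorem Fm.holds_eval (E : Rules L) (M : FOStruct.{u} L) {ok : L.DRel → Prop} {hole : Prop}
    {J : ∀ R, ok R → ∀ W : Srt → Type, ℕ →
      (∀ i : Fin (L.drargs R).length, Val L W ((L.drargs R).get i)) → FOFm L W}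
    {J' : ∀ R, ok R → ℕ → (∀ i : Fin (L.drargs R).length, SVal M ((L.drargs R).get i)) → Prop}
    (hJ : ∀ R h (W : Srt → Type) (v : ∀ s, W s → M.dom s) n args,
      (J R h W n args).Holds M v ↔ J' R h n fun i => Val.sem M v _ (args i))
    {V : Kind → Type} (A : Fm L ok hole V) {W : Srt → Type} (v : ∀ s, W s → M.dom s)
    (c : hole → FOFm L W) (c' : hole → Prop) (hc : ∀ h, (c h).Holds M v ↔ c' h)
    (ρ : ∀ κ, V κ → Val L W κ) :
    (A.eval E J c ρ).Holds M v ↔ A.sem E M J' c' fun κ x => Val.sem M v κ (ρ κ x) := by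
  induction A generalizing W with
  | rel R args => simp only [sem, eval, FOFm.Holds, ← sem_tmVal]; rfl
  | drel R h t args => simp only [sem, eval, ← sem_tmVal]; exact hJ _ _ _ _ _ _
  | call h => exact hc h
  | neg A ih => simp only [sem, eval, FOFm.Holds, ih v c hc]
  | and A B ihA ihB => simp only [sem, eval, FOFm.Holds, ihA v c hc, ihB v c hc]
  | or A B ihA ihB => simp only [sem, eval, FOFm.Holds, ihA v c hc, ihB v c hc]
  | imp A B ihA ihB => simp only [sem, eval, FOFm.Holds, ihA v c hc, ihB v c hc]
  | all s A ih =>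
    simp only [sem, eval, FOFm.Holds]
    refine forall_congr' fun d => ?_
    rw [ih (extend M v d) _ (fun h => (FOFm.holds_rename M _ _ _).trans (hc h)), sem_liftEnv]
  | ex s A ih =>
    simp only [sem, eval, FOFm.Holds]
    refine exists_congr fun d => ?_
    rw [ih (extend M v d) _ (fun h => (FOFm.holds_rename M _ _ _).trans (hc h)), sem_liftEnv]

theorem holds_relVal (E : Rules L) (M : FOStruct.{u} L) (R : L.DRel) (W : Srt → Type)
    (v : ∀ s, W s → M.dom s) (n : ℕ)
    (args : ∀ i : Fin (L.drargs R).length, Val L W ((L.drargs R).get i)) :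
    (relVal E R W n args).Holds M v ↔ relSem E M R n fun i => Val.sem M v _ (args i) := by
  induction R using L.rprec_wf.induction generalizing W n with
  | _ R IH =>
    induction n with
    | zero =>
      rw [relVal_zero, relSem_zero,
        Fm.holds_eval E M (fun Q hQ W v n args => IH Q hQ W v n args) _ v _ (fun h => h.elim)
          (fun h => h.elim)]
      apply iff_of_eq
      congr 1; funext κ x; cases x; rfl
    | succ n ih =>
      rw [relVal_succ, relSem_succ,
        Fm.holds_eval E M (fun Q hQ W v n args => IH Q hQ W v n args) _ v _ _ (fun _ => ih)]
      apply iff_of_eq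
      congr 1; funext κ x; cases x <;> rfl

/-- The normal form of a formula is true in a structure exactly if the formula is true there under
the semantic values of its environment. -/
theorem holds_fmVal (E : Rules L) (M : FOStruct.{u} L) {W : Srt → Type} (v : ∀ s, W s → M.dom s)
    {V : Kind → Type} (ρ : ∀ κ, V κ → Val L W κ) (A : Form L V) :
    (fmVal E ρ A).Holds M v ↔ fmSem E M (fun κ x => Val.sem M v κ (ρ κ x)) A :=
  Fm.holds_eval E M (fun R _ W v n args => holds_relVal E M R W v n args) A v _ _
    (fun h => h.elim) ρ

/-! ### Substitution and the equational theory -/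

theorem Tm.sem_subst (M : FOStruct.{u} L) {ok ok' : L.DFn → Prop} {V W : Kind → Type}
    (I : ∀ f, ℕ → (∀ i : Fin (L.dfargs f).length, SVal M ((L.dfargs f).get i)) →
      SVal M (L.dfres f))
    (h : ∀ f, ok f → ok' f) (σ : ∀ κ, V κ → Tm L ok' W κ) (ρ : ∀ κ, W κ → SVal M κ)
    {κ : Kind} (t : Tm L ok V κ) :
    (t.subst h σ).sem M (fun f _ => I f) ρ =
      t.sem M (fun f _ => I f) fun κ x => (σ κ x).sem M (fun f _ => I f) ρ := by
  induction t with
  | var x => rfl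
  | app X t ihX iht => simp only [subst, sem, ihX, iht]; rfl
  | azero => rfl
  | asucc t ih => simp only [subst, sem, ih]; rfl
  | num t ih => simp only [subst, sem, ih]; rfl
  | succ t ih => simp only [subst, sem, ih]; rfl
  | fn f args ih => simp only [subst, sem, ih]; rfl
  | dfn f h t args iht ih => simp only [subst, sem, ih, iht]

theorem tmSem_subst (E : Rules L) (M : FOStruct.{u} L) {V W : Kind → Type}
    (h : ∀ _ : L.DFn, True → True) (σ : ∀ κ, V κ → Term L W κ) (ρ : ∀ κ, W κ → SVal M κ)
    {κ : Kind} (t : Term L V κ) :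
    tmSem E M ρ (t.subst h σ) = tmSem E M (fun κ x => tmSem E M ρ (σ κ x)) t :=
  Tm.sem_subst M (fnSem E M) _ σ ρ t

theorem Fm.sem_rename (E : Rules L) (M : FOStruct.{u} L) {ok : L.DRel → Prop} {hole : Prop}
    (J : ∀ R, ok R → ℕ → (∀ i : Fin (L.drargs R).length, SVal M ((L.drargs R).get i)) → Prop)
    (c : hole → Prop) {V W : Kind → Type} (r : ∀ κ, V κ → W κ) (ρ : ∀ κ, W κ → SVal M κ)
    (A : Fm L ok hole V) :
    (A.rename r).sem E M J c ρ ↔ A.sem E M J c fun κ x => ρ κ (r κ x) := by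
  have key : ∀ {V W : Kind → Type} (r : ∀ κ, V κ → W κ) (ρ : ∀ κ, W κ → SVal M κ) (s : Srt)
      (d : M.dom s), (fun κ x => extendSEnv ρ d κ (liftRen s r κ x)) =
        extendSEnv (fun κ x => ρ κ (r κ x)) d := by
    intro V W r ρ s d; funext κ x; cases x <;> rfl
  induction A generalizing W with
  | rel R args => simp only [rename, sem, tmSem_subst]; rfl
  | drel R h t args => simp only [rename, sem, tmSem_subst]; rfl
  | call h => rfl
  | neg A ih => simp only [rename, sem, ih]
  | and A B ihA ihB => simp only [rename, sem, ihA, ihB]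
  | or A B ihA ihB => simp only [rename, sem, ihA, ihB]
  | imp A B ihA ihB => simp only [rename, sem, ihA, ihB]
  | all s A ih => simp only [rename, sem, ih, key]
  | ex s A ih => simp only [rename, sem, ih, key]

theorem tmSem_liftSub (E : Rules L) (M : FOStruct.{u} L) {V W : Kind → Type} {s : Srt}
    (σ : ∀ κ, V κ → Term L W κ) (ρ : ∀ κ, W κ → SVal M κ) (d : M.dom s) :
    (fun κ x => tmSem E M (extendSEnv ρ d) (liftSub s σ κ x)) =
      extendSEnv (fun κ x => tmSem E M ρ (σ κ x)) d := by
  funext κ x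
  cases x with
  | old x => exact tmSem_subst E M _ _ _ _
  | new => rfl

/-- Substitution of terms becomes composition of environments; a formula substituted for the
place-holder enters by its truth value, which binders do not affect. -/
theorem Fm.sem_inst (E : Rules L) (M : FOStruct.{u} L) {ok ok' : L.DRel → Prop}
    {hole hole' : Prop} (hok : ∀ R, ok R → ok' R)
    (J : ∀ R, ℕ → (∀ i : Fin (L.drargs R).length, SVal M ((L.drargs R).get i)) → Prop)
    (c' : hole' → Prop) {V W : Kind → Type} (c : hole → Fm L ok' hole' W)
    (σ : ∀ κ, V κ → Term L W κ) (ρ : ∀ κ, W κ → SVal M κ) (A : Fm L ok hole V) :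
    (A.inst hok c σ).sem E M (fun R _ => J R) c' ρ ↔
      A.sem E M (fun R _ => J R) (fun h => (c h).sem E M (fun R _ => J R) c' ρ)
        fun κ x => tmSem E M ρ (σ κ x) := by
  induction A generalizing W with
  | rel R args => simp only [inst, sem, tmSem_subst]
  | drel R h t args => simp only [inst, sem, tmSem_subst]
  | call h => rfl
  | neg A ih => simp only [inst, sem, ih]
  | and A B ihA ihB => simp only [inst, sem, ihA, ihB]
  | or A B ihA ihB => simp only [inst, sem, ihA, ihB]
  | imp A B ihA ihB => simp only [inst, sem, ihA, ihB]
  | all s A ih => simp only [inst, sem, ih, sem_rename, tmSem_liftSub]; rfl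
  | ex s A ih => simp only [inst, sem, ih, sem_rename, tmSem_liftSub]; rfl

theorem fmSem_subst (E : Rules L) (M : FOStruct.{u} L) {V W : Kind → Type}
    (σ : ∀ κ, V κ → Term L W κ) (ρ : ∀ κ, W κ → SVal M κ) (A : Form L V) :
    fmSem E M ρ (subst σ A) ↔ fmSem E M (fun κ x => tmSem E M ρ (σ κ x)) A := by
  have hc : (fun h : False => Fm.sem E M (fun R _ => relSem E M R) (fun h => h.elim) ρ
      (h.elim : Form L W)) = fun h => h.elim := funext fun h => h.elim
  rw [fmSem, fmSem, subst, Fm.sem_inst, hc]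

theorem fmSem_instantiate (E : Rules L) (M : FOStruct.{u} L) {V : Kind → Type} {s : Srt}
    (ρ : ∀ κ, V κ → SVal M κ) (A : Form L (Bind V s)) (t : Term L V (.fo s)) :
    fmSem E M ρ (instantiate A t) ↔ fmSem E M (extendSEnv ρ (tmSem E M ρ t : M.dom s)) A := by
  rw [instantiate, fmSem_subst]
  apply iff_of_eq
  congr 1; funext κ x; cases x <;> rfl

theorem TmEq.tmSem_eq {E : Rules L} (M : FOStruct.{u} L) {V : Kind → Type}
    (ρ : ∀ κ, V κ → SVal M κ) {κ : Kind} {t t' : Term L V κ} (h : TmEq E t t') :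
    tmSem E M ρ t = tmSem E M ρ t' := by
  induction h with
  | refl => rfl
  | symm _ ih => exact ih.symm
  | trans _ _ ih ih' => exact ih.trans ih'
  | app _ _ ih ih' => simp only [tmSem, Tm.sem] at ih ih' ⊢; rw [ih, ih']
  | asucc _ ih => simp only [tmSem, Tm.sem] at ih ⊢; rw [ih]
  | num _ ih => simp only [tmSem, Tm.sem] at ih ⊢; rw [ih]
  | succ _ ih => simp only [tmSem, Tm.sem] at ih ⊢; rw [ih]
  | fn _ ih => simp only [tmSem, Tm.sem] at ih ⊢; simp only [ih]; rfl
  | dfn _ _ ih ih' => simp only [tmSem, Tm.sem] at ih ih' ⊢; simp only [ih, ih']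
  | num_succ t => rfl
  | rule_base f args =>
    refine (fnSem_zero E M f _).trans ?_
    rw [tmSem, Tm.sem_subst M (fnSem E M)]
    congr 1; funext κ x; cases x; rfl
  | rule_step f t args =>
    refine (fnSem_succ E M f _ _).trans ?_
    rw [tmSem, Tm.sem_subst M (fnSem E M)]
    congr 1; funext κ x; cases x <;> rfl

theorem FmEq.fmSem_iff {E : Rules L} (M : FOStruct.{u} L) {V : Kind → Type}
    {A B : Form L V} (h : FmEq E A B) (ρ : ∀ κ, V κ → SVal M κ) :
    fmSem E M ρ A ↔ fmSem E M ρ B := by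
  induction h with
  | refl => rfl
  | symm _ ih => exact (ih ρ).symm
  | trans _ _ ih ih' => exact (ih ρ).trans (ih' ρ)
  | rel h => simp only [fmSem, Fm.sem, fun i => (h i).tmSem_eq M ρ]
  | drel h h' => simp only [fmSem, Fm.sem, h.tmSem_eq M ρ, fun i => (h' i).tmSem_eq M ρ]
  | neg _ ih => exact not_congr (ih ρ)
  | and _ _ ih ih' => exact and_congr (ih ρ) (ih' ρ)
  | or _ _ ih ih' => exact or_congr (ih ρ) (ih' ρ)
  | imp _ _ ih ih' => exact imp_congr (ih ρ) (ih' ρ)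
  | all _ ih => exact forall_congr' fun d => ih _
  | ex _ ih => exact exists_congr fun d => ih _
  | rule_base R args =>
    refine (relSem_zero E M R _).trans ?_
    rw [fmSem, Fm.sem_inst]
    apply iff_of_eq
    congr 1
    · funext h; exact h.elim
    · funext κ x; cases x; rfl
  | rule_step R t args =>
    refine (relSem_succ E M R _ _).trans ?_
    rw [fmSem, Fm.sem_inst]
    apply iff_of_eq
    congr 1; funext κ x; cases x <;> rfl

/-! ### Dependence of truth values on the assignment -/

theorem FOTm.val_congr (M : FOStruct.{u} L) {W : Srt → Type} {v v' : ∀ s, W s → M.dom s} {s : Srt}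
    (t : FOTm L W s) (h : ∀ s (x : W s), t.Occ x → v s x = v' s x) : t.val M v = t.val M v' := by
  induction t with
  | var x => exact h _ x .var
  | zero => rfl
  | succ t ih => simp only [val, ih fun s x hx => h s x (.succ hx)]
  | fn f args ih => simp only [val, fun i => ih i fun s x hx => h s x (.fn i hx)]

theorem FOFm.holds_congr (M : FOStruct.{u} L) {W : Srt → Type} {v v' : ∀ s, W s → M.dom s}
    (A : FOFm L W) (h : ∀ s (x : W s), A.Occ x → v s x = v' s x) :
    A.Holds M v ↔ A.Holds M v' := by
  have key : ∀ {W : Srt → Type} {v v' : ∀ s, W s → M.dom s} {s : Srt} (A : FOFm L (FOBind W s))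
      (_ : ∀ s' (x : W s'), A.Occ (.old x) → v s' x = v' s' x) (d : M.dom s) (s' : Srt)
      (x : FOBind W s s'), A.Occ x → extend M v d s' x = extend M v' d s' x := by
    intro W v v' s A h d s' x hx
    cases x with
    | old x => exact h s' x hx
    | new => rfl
  induction A with
  | rel R args =>
    simp only [Holds, fun i => (args i).val_congr M fun s x hx => h s x ⟨i, hx⟩]
  | neg A ih => exact not_congr (ih h)
  | and A B ihA ihB =>
    exact and_congr (ihA fun s x hx => h s x (.inl hx)) (ihB fun s x hx => h s x (.inr hx))
  | or A B ihA ihB =>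
    exact or_congr (ihA fun s x hx => h s x (.inl hx)) (ihB fun s x hx => h s x (.inr hx))
  | imp A B ihA ihB =>
    exact imp_congr (ihA fun s x hx => h s x (.inl hx)) (ihB fun s x hx => h s x (.inr hx))
  | all s A ih => exact forall_congr' fun d => ih (key A h d)
  | ex s A ih => exact exists_congr fun d => ih (key A h d)

theorem FOSeq.holds_congr (M : FOStruct.{u} L) {v v' : ∀ s, FOVar s → M.dom s} (C : FOSeq L)
    (h : ∀ s (x : FOVar s), C.Occ x → v s x = v' s x) : C.Holds M v ↔ C.Holds M v' :=
  imp_congr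
    (forall₂_congr fun A hA => A.holds_congr M fun s x hx => h s x (.inl ⟨A, hA, hx⟩))
    (exists_congr fun A => and_congr_right fun hA =>
      A.holds_congr M fun s x hx => h s x (.inr ⟨A, hA, hx⟩))

theorem FOSeq.holds_merge (M : FOStruct.{u} L) (v : ∀ s, FOVar s → M.dom s) (C D : FOSeq L) :
    (C.merge D).Holds M v ↔ C.Holds M v ∨ D.Holds M v := by
  have h : ∀ a b c d : Prop, (a ∧ b → c ∨ d) ↔ (a → c) ∨ (b → d) := by tauto
  simp only [Holds, merge, Multiset.mem_add, or_imp, forall_and, or_and_right, exists_or]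
  exact h _ _ _ _

end Semantics

/-! ### Marked occurrences -/

section Marked

variable {α : Type*}

theorem marked_cons (m : List Bool) (a : α) (l : List α) :
    marked m (a :: l) = if m.headD false = true then a :: marked m.tail l else marked m.tail l := by
  rcases m with _ | ⟨_ | _, m⟩
  · cases l <;> rfl
  · rfl
  · rfl

theorem marked_nil_left (l : List α) : marked [] l = [] := by cases l <;> rfl

theorem marked_nil_right (m : List Bool) : marked m ([] : List α) = [] := by
  rcases m with _ | ⟨_ | _, m⟩ <;> rfl

theorem marked_append (m : List Bool) (l l' : List α) :
    marked m (l ++ l') = marked (m.take l.length) l ++ marked (m.drop l.length) l' := by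
  induction l generalizing m with
  | nil => simp [marked_nil_right]
  | cons a l ih =>
    rcases m with _ | ⟨_ | _, m⟩
    · simp [marked_nil_left]
    · simp [marked, ih]
    · simp [marked, ih]

theorem marked_map {α' : Type*} (f : α → α') (m : List Bool) (l : List α) :
    marked m (l.map f) = (marked m l).map f := by
  induction l generalizing m with
  | nil => simp [marked_nil_right]
  | cons a l ih =>
    rcases m with _ | ⟨_ | _, m⟩
    · simp [marked_nil_left]
    · simp [marked, ih]
    · simp [marked, ih]

theorem marked_eq_nil_of_forall_false (l l' : List α) :
    marked (l'.map fun _ => false) l = [] := by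
  induction l generalizing l' with
  | nil => exact marked_nil_right _
  | cons a l ih =>
    cases l' with
    | nil => rfl
    | cons _ l' => exact ih l'

theorem mem_of_mem_marked {m : List Bool} {l : List α} {a : α} (h : a ∈ marked m l) : a ∈ l := by
  induction l generalizing m with
  | nil => simp [marked_nil_right] at h
  | cons b l ih =>
    rw [marked_cons] at h
    split at h
    · rcases List.mem_cons.1 h with rfl | h
      · exact List.mem_cons_self
      · exact List.mem_cons_of_mem _ (ih h)
    · exact List.mem_cons_of_mem _ (ih h)

theorem length_swapAt (i : ℕ) (l : List α) : (swapAt i l).length = l.length := by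
  induction l generalizing i with
  | nil => cases i <;> rfl
  | cons a l ih =>
    cases i with
    | zero => cases l <;> rfl
    | succ i => simp [swapAt, ih]

/-- Moving an exchange from the occurrences to their marks permutes the marked members.  On lists of
different lengths this fails, since missing marks are read as unmarked. -/
theorem marked_swapAt_perm (i : ℕ) (m : List Bool) (l : List α) (h : m.length = l.length) :
    (marked (swapAt i m) l).Perm (marked m (swapAt i l)) := by
  induction l generalizing i m with
  | nil => cases m with
    | nil => cases i <;> rfl
    | cons => simp at h
  | cons a l ih =>
    cases m with
    | nil => simp at h
    | cons x m =>
      cases i with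
      | zero =>
        cases l with
        | nil => cases m with
          | nil => rfl
          | cons => simp at h
        | cons b l => cases m with
          | nil => simp at h
          | cons y m => cases x <;> cases y <;> simp [swapAt, marked, List.Perm.swap]
      | succ i =>
        have := ih i m (by simpa using h)
        cases x <;> simp [swapAt, marked, this]

/-- All marked members of a list satisfy `T`. -/
def AllMarked (T : α → Prop) (m : List Bool) (l : List α) : Prop := ∀ a ∈ marked m l, T a

/-- Some marked member of a list satisfies `T`. -/
def SomeMarked (T : α → Prop) (m : List Bool) (l : List α) : Prop := ∃ a ∈ marked m l, T a

theorem allMarked_cons (T : α → Prop) (m : List Bool) (a : α) (l : List α) :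
    AllMarked T m (a :: l) ↔ (m.headD false = true → T a) ∧ AllMarked T m.tail l := by
  rw [AllMarked, marked_cons, AllMarked]
  split <;> simp_all

theorem someMarked_cons (T : α → Prop) (m : List Bool) (a : α) (l : List α) :
    SomeMarked T m (a :: l) ↔ (m.headD false = true ∧ T a) ∨ SomeMarked T m.tail l := by
  rw [SomeMarked, marked_cons, SomeMarked]
  split <;> simp_all

theorem allMarked_append (T : α → Prop) (m : List Bool) (l l' : List α) :
    AllMarked T m (l ++ l') ↔
      AllMarked T (m.take l.length) l ∧ AllMarked T (m.drop l.length) l' := by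
  simp only [AllMarked, marked_append, List.forall_mem_append]

theorem someMarked_append (T : α → Prop) (m : List Bool) (l l' : List α) :
    SomeMarked T m (l ++ l') ↔
      SomeMarked T (m.take l.length) l ∨ SomeMarked T (m.drop l.length) l' := by
  simp only [SomeMarked, marked_append, List.mem_append, or_and_right, exists_or]

theorem allMarked_swapAt (T : α → Prop) (i : ℕ) (m : List Bool) (l : List α)
    (h : m.length = l.length) : AllMarked T (swapAt i m) l ↔ AllMarked T m (swapAt i l) :=
  forall_congr' fun _ => imp_congr_left (marked_swapAt_perm i m l h).mem_iff

theorem someMarked_swapAt (T : α → Prop) (i : ℕ) (m : List Bool) (l : List α)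
    (h : m.length = l.length) : SomeMarked T (swapAt i m) l ↔ SomeMarked T m (swapAt i l) :=
  exists_congr fun _ => and_congr_left' (marked_swapAt_perm i m l h).mem_iff

theorem allMarked_map {α' : Type*} (T : α' → Prop) (f : α → α') (m : List Bool) (l : List α) :
    AllMarked T m (l.map f) ↔ AllMarked (fun a => T (f a)) m l := by
  simp only [AllMarked, marked_map, List.forall_mem_map]

theorem someMarked_map {α' : Type*} (T : α' → Prop) (f : α → α') (m : List Bool) (l : List α) :
    SomeMarked T m (l.map f) ↔ SomeMarked (fun a => T (f a)) m l := by
  simp [SomeMarked, marked_map]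

theorem allMarked_congr {T T' : α → Prop} (m : List Bool) (l : List α)
    (h : ∀ a ∈ l, (T a ↔ T' a)) : AllMarked T m l ↔ AllMarked T' m l :=
  forall₂_congr fun a ha => h a (mem_of_mem_marked ha)

theorem someMarked_congr {T T' : α → Prop} (m : List Bool) (l : List α)
    (h : ∀ a ∈ l, (T a ↔ T' a)) : SomeMarked T m l ↔ SomeMarked T' m l :=
  exists_congr fun a => and_congr_right fun ha => h a (mem_of_mem_marked ha)

end Marked

/-! ### Regular proofs and locally refuted clause sets -/

section Support

variable {L : Sym} (M : FOStruct.{u} L)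

/-- The clause-set term `t` supports the property `P` of assignments along the proof tree `T`: the
variables of the clauses occur in `T`, and, if `T` is regular, `P` holds at each assignment `v` such
that the clauses are true at all assignments which differ from `v` on eigenvariables of `T` only. -/
def Supports (T : PTree L) (t : NClTerm L) (P : (∀ s, FOVar s → M.dom s) → Prop) : Prop :=
  (∀ C ∈ t.clauses, ∀ s (x : FOVar s), C.Occ x → T.Occ ⟨s, x⟩) ∧
    (T.IsRegular → ∀ v, (∀ v' : (∀ s, FOVar s → M.dom s),
      (∀ s (x : FOVar s), ¬ T.IsEigen ⟨s, x⟩ → v' s x = v s x) → ∀ C ∈ t.clauses, C.Holds M v') →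
        P v)

variable {M}

theorem Supports.mono {T : PTree L} {t : NClTerm L} {P P' : (∀ s, FOVar s → M.dom s) → Prop}
    (h : Supports M T t P) (hP : ∀ v, P v → P' v) : Supports M T t P' :=
  ⟨h.1, fun hT v hv => hP v (h.2 hT v hv)⟩

theorem Supports.unary {T : PTree L} {t : NClTerm L} {P P' : (∀ s, FOVar s → M.dom s) → Prop}
    (C : FOSeq L) (h : Supports M T t P) (hP : ∀ v, P v → P' v) :
    Supports M (.unary C none T) t P' := by
  refine ⟨fun D hD s x hx => .inr (.inr (h.1 D hD s x hx)), fun hT v hv => hP v (h.2 hT.1 v ?_)⟩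
  intro v' hv'
  refine hv v' fun s x hx => hv' s x fun hx' => hx (.inr hx')

/-- At a strong quantifier inference the premise may be used for every value of the eigenvariable,
which does not occur in the conclusion. -/
theorem Supports.unary_eigen {T : PTree L} {t : NClTerm L}
    {P P' : (∀ s, FOVar s → M.dom s) → Prop} (C : FOSeq L) (x : Σ s, FOVar s)
    (h : Supports M T t P)
    (hP : ¬ C.Occ x.2 → ∀ v, (∀ v' : (∀ s, FOVar s → M.dom s),
      (∀ s (y : FOVar s), ⟨s, y⟩ ≠ x → v' s y = v s y) → P v') → P' v) :
    Supports M (.unary C (some x) T) t P' := by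
  refine ⟨fun D hD s y hy => .inr (.inr (h.1 D hD s y hy)), fun hT v hv => ?_⟩
  refine hP (hT.2.2 x (.inl rfl)) v fun v' hv' => h.2 hT.1 v' fun v'' hv'' => ?_
  refine hv v'' fun s y hy => ?_
  rw [hv'' s y fun h' => hy (.inr h'), hv' s y fun h' => hy (.inl (by rw [h']))]

theorem Supports.plus {T T' : PTree L} {t t' : NClTerm L}
    {P P' Q : (∀ s, FOVar s → M.dom s) → Prop} (C : FOSeq L) (h : Supports M T t P)
    (h' : Supports M T' t' P') (hQ : ∀ v, P v → P' v → Q v) :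
    Supports M (.binary C T T') (.plus t t') Q := by
  refine ⟨?_, fun hT v hv => hQ v (h.2 hT.1 v ?_) (h'.2 hT.2.1 v ?_)⟩
  · rintro D (hD | hD) s x hx
    · exact .inr (.inl (h.1 D hD s x hx))
    · exact .inr (.inr (h'.1 D hD s x hx))
  · exact fun v' hv' D hD => hv v' (fun s x hx => hv' s x fun hx' => hx (.inl hx')) D (.inl hD)
  · exact fun v' hv' D hD => hv v' (fun s x hx => hv' s x fun hx' => hx (.inr hx')) D (.inr hD)

/-- If neither `P` nor `P'` holds at `v`, then there are clauses on either side that fail at variants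
of `v`.  By regularity the eigenvariables of one premise do not occur in the clauses of the other
one, so that the two variants can be glued, and the merge of the two clauses fails there. -/
theorem Supports.times {T T' : PTree L} {t t' : NClTerm L}
    {P P' Q : (∀ s, FOVar s → M.dom s) → Prop} (C : FOSeq L) (h : Supports M T t P)
    (h' : Supports M T' t' P') (hQ : ∀ v, P v ∨ P' v → Q v) :
    Supports M (.binary C T T') (.times t t') Q := by
  classical
  refine ⟨?_, fun hT v hv => hQ v ?_⟩
  · rintro _ ⟨D, hD, D', hD', rfl⟩ s x hx
    have hx' : D.Occ x ∨ D'.Occ x := by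
      rcases hx with ⟨A, hA, hx⟩ | ⟨A, hA, hx⟩
      · exact (Multiset.mem_add.1 hA).imp (fun hA => .inl ⟨A, hA, hx⟩) fun hA => .inl ⟨A, hA, hx⟩
      · exact (Multiset.mem_add.1 hA).imp (fun hA => .inr ⟨A, hA, hx⟩) fun hA => .inr ⟨A, hA, hx⟩
    exact hx'.elim (fun hx => .inr (.inl (h.1 D hD s x hx)))
      fun hx => .inr (.inr (h'.1 D' hD' s x hx))
  by_contra hPP
  obtain ⟨hP, hP'⟩ := not_or.1 hPP
  have h₁ := mt (h.2 hT.1 v) hP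
  have h₂ := mt (h'.2 hT.2.1 v) hP'
  push Not at h₁ h₂
  obtain ⟨v₁, hv₁, D₁, hD₁, hf₁⟩ := h₁
  obtain ⟨v₂, hv₂, D₂, hD₂, hf₂⟩ := h₂
  let w : ∀ s, FOVar s → M.dom s := fun s x =>
    if T.IsEigen ⟨s, x⟩ then v₁ s x else if T'.IsEigen ⟨s, x⟩ then v₂ s x else v s x
  have hw := hv w (fun s x hx => by
    rw [show w s x = _ from if_neg fun h => hx (.inl h), if_neg fun h => hx (.inr h)]) _
      ⟨D₁, hD₁, D₂, hD₂, rfl⟩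
  rcases (FOSeq.holds_merge M w D₁ D₂).1 hw with hw | hw
  · refine hf₁ ((FOSeq.holds_congr M D₁ fun s x hx => ?_).1 hw)
    by_cases hE : T.IsEigen ⟨s, x⟩
    · exact if_pos hE
    · have hE' : ¬ T'.IsEigen ⟨s, x⟩ := fun hE' =>
        (hT.2.2.2 ⟨s, x⟩ hE').1 (h.1 D₁ hD₁ s x hx)
      rw [hv₁ s x hE, show w s x = _ from if_neg hE, if_neg hE']
  · refine hf₂ ((FOSeq.holds_congr M D₂ fun s x hx => ?_).1 hw)
    have hE : ¬ T.IsEigen ⟨s, x⟩ := fun hE =>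
      (hT.2.2.1 ⟨s, x⟩ hE).1 (h'.1 D₂ hD₂ s x hx)
    rw [show w s x = _ from if_neg hE]
    by_cases hE' : T'.IsEigen ⟨s, x⟩
    · exact if_pos hE'
    · rw [hv₂ s x hE', if_neg hE']

end Support

/-! ### Soundness of the characteristic term of a proof -/

section Soundness

variable {L : Sym} {N : ℕ}

/-- The semantic environment given by an assignment and an environment of syntactic values. -/
def semEnv (M : FOStruct.{u} L) {V : Kind → Type} (ρ : ∀ κ, V κ → Val L FOVar κ)
    (v : ∀ s, FOVar s → M.dom s) : ∀ κ, V κ → SVal M κ :=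
  fun κ x => Val.sem M v κ (ρ κ x)

/-- The subsequent of `Γ ⊢ Δ` consisting of the marked occurrences is true. -/
def MarkedTrue (E : Rules L) (M : FOStruct.{u} L) {V : Kind → Type} (m m' : List Bool)
    (Γ Δ : List (Form L V)) (ρ : ∀ κ, V κ → SVal M κ) : Prop :=
  AllMarked (fmSem E M ρ) m Γ → SomeMarked (fmSem E M ρ) m' Δ

theorem fmVal_all (E : Rules L) {V : Kind → Type} {W : Srt → Type} (ρ : ∀ κ, V κ → Val L W κ)
    {s : Srt} (A : Form L (Bind V s)) :
    fmVal E ρ (.all s A) = .all s (fmVal E (liftEnv s ρ) A) := by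
  have h : (fun h : False => (h.elim : FOFm L W).rename fun _ x => FOBind.old (s := s) x) =
    fun h => h.elim := funext fun h => h.elim
  rw [fmVal, Fm.eval, h]; rfl

theorem fmVal_ex (E : Rules L) {V : Kind → Type} {W : Srt → Type} (ρ : ∀ κ, V κ → Val L W κ)
    {s : Srt} (A : Form L (Bind V s)) :
    fmVal E ρ (.ex s A) = .ex s (fmVal E (liftEnv s ρ) A) := by
  have h : (fun h : False => (h.elim : FOFm L W).rename fun _ x => FOBind.old (s := s) x) =
    fun h => h.elim := funext fun h => h.elim
  rw [fmVal, Fm.eval, h]; rfl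

theorem fmSem_congr (E : Rules L) (M : FOStruct.{u} L) {V : Kind → Type}
    (ρ : ∀ κ, V κ → Val L FOVar κ) {v v' : ∀ s, FOVar s → M.dom s} (A : Form L V)
    (h : ∀ s (x : FOVar s), (fmVal E ρ A).Occ x → v s x = v' s x) :
    fmSem E M (semEnv M ρ v) A ↔ fmSem E M (semEnv M ρ v') A := by
  unfold semEnv
  rw [← holds_fmVal, ← holds_fmVal]
  exact FOFm.holds_congr M _ h

/-- A variable that does not occur in the quantified formula is irrelevant for its matrix. -/
theorem fmSem_extendSEnv_congr (E : Rules L) (M : FOStruct.{u} L) {V : Kind → Type}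
    (ρ : ∀ κ, V κ → Val L FOVar κ) {v v' : ∀ s, FOVar s → M.dom s} {s : Srt}
    (A : Form L (Bind V s)) (d : M.dom s)
    (h : ∀ s' (x : FOVar s'), (fmVal E (liftEnv s ρ) A).Occ (.old x) → v s' x = v' s' x) :
    fmSem E M (extendSEnv (semEnv M ρ v) d) A ↔ fmSem E M (extendSEnv (semEnv M ρ v') d) A := by
  unfold semEnv
  rw [← sem_liftEnv, ← sem_liftEnv, ← holds_fmVal, ← holds_fmVal]
  refine FOFm.holds_congr M _ fun s' x hx => ?_
  cases x with
  | old x => exact h s' x hx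
  | new => rfl

theorem exists_update {M : FOStruct.{u} L} (v : ∀ s, FOVar s → M.dom s) {s : Srt} (x : FOVar s)
    (d : M.dom s) : ∃ v' : (∀ s, FOVar s → M.dom s), v' s x = d ∧
      ∀ s' (y : FOVar s'), (⟨s', y⟩ : Σ s, FOVar s) ≠ ⟨s, x⟩ → v' s' y = v s' y := by
  classical
  refine ⟨fun s' y => if h : (⟨s', y⟩ : Σ s, FOVar s) = ⟨s, x⟩ then
    cast (congrArg (fun z : Σ s, FOVar s => M.dom z.1) h.symm) d else v s' y, ?_, ?_⟩
  · simp
  · intro s' y h; exact dif_neg h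

/-- Some variant of an assignment gives the eigenvariable any prescribed value. -/
theorem exists_update_eigen (E : Rules L) {M : FOStruct.{u} L} {b : Bool} {ps : List Kind}
    (n : ℕ) (args : Args L ps) {s : Srt} (e : Eigen L b ps s) (v : ∀ s, FOVar s → M.dom s)
    (d : M.dom s) : ∃ v' : (∀ s, FOVar s → M.dom s),
      tmSem E M (semEnv M (paramEnv b n args) v') e.toTerm = d ∧
      ∀ s' (y : FOVar s'), ⟨s', y⟩ ≠ e.eval E (paramEnv b n args) → v' s' y = v s' y := by
  cases e with
  | fv s i => exact exists_update v (.fv s i) d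
  | sv X t =>
    obtain ⟨v', h, h'⟩ := exists_update v (.sv X (tmVal E (paramEnv b n args) t)) d
    refine ⟨v', ?_, h'⟩
    refine Eq.trans ?_ h
    have ht := sem_tmVal E M v' (paramEnv b n args) t
    change v' _ (FOVar.sv X (ULift.down (tmSem E M _ t : ULift ℕ))) = _
    rw [show tmSem E M (semEnv M (paramEnv b n args) v') t = _ from ht.symm]; rfl

theorem mem_occ_evalSeq (E : Rules L) {b : Bool} {ps : List Kind} (ρ : PEnv L b ps)
    {Γ Δ : List (Form L (PVar b ps))} {s : Srt} {x : FOVar s} {A : Form L (PVar b ps)}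
    (hA : A ∈ Γ ∨ A ∈ Δ) (hx : (fmVal E ρ A).Occ x) : (evalSeq E ρ Γ Δ).Occ x := by
  rcases hA with hA | hA
  · exact .inl ⟨_, by simpa [evalSeq] using ⟨A, hA, rfl⟩, hx⟩
  · exact .inr ⟨_, by simpa [evalSeq] using ⟨A, hA, rfl⟩, hx⟩

/-- Assignments that differ only on a variable not occurring in an evaluated sequent give the same
truth values to the members of the sequent. -/
theorem fmSem_congr_of_not_occ (E : Rules L) (M : FOStruct.{u} L) {b : Bool} {ps : List Kind}
    (ρ : PEnv L b ps) {Γ Δ : List (Form L (PVar b ps))} {x : Σ s, FOVar s}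
    (hx : ¬ (evalSeq E ρ Γ Δ).Occ x.2) {v v' : ∀ s, FOVar s → M.dom s}
    (hv : ∀ s (y : FOVar s), ⟨s, y⟩ ≠ x → v' s y = v s y) {A : Form L (PVar b ps)}
    (hA : A ∈ Γ ∨ A ∈ Δ) :
    fmSem E M (semEnv M ρ v') A ↔ fmSem E M (semEnv M ρ v) A := by
  refine fmSem_congr E M ρ A fun s y hy => hv s y ?_
  rintro rfl
  exact hx (mem_occ_evalSeq E ρ hA hy)

theorem holds_evalSeq_marked (E : Rules L) (M : FOStruct.{u} L) {b : Bool} {ps : List Kind}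
    (ρ : PEnv L b ps) (m m' : List Bool) (Γ Δ : List (Form L (PVar b ps)))
    (v : ∀ s, FOVar s → M.dom s) :
    (evalSeq E ρ (marked m Γ) (marked m' Δ)).Holds M v ↔
      MarkedTrue E M m m' Γ Δ (semEnv M ρ v) := by
  simp [FOSeq.Holds, evalSeq, MarkedTrue, AllMarked, SomeMarked, holds_fmVal]
  rfl

theorem occ_evalSeq_marked (E : Rules L) {b : Bool} {ps : List Kind} (ρ : PEnv L b ps)
    {m m' : List Bool} {Γ Δ : List (Form L (PVar b ps))} {s : Srt} {x : FOVar s}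
    (h : (evalSeq E ρ (marked m Γ) (marked m' Δ)).Occ x) : (evalSeq E ρ Γ Δ).Occ x := by
  rcases h with ⟨B, hB, hx⟩ | ⟨B, hB, hx⟩
  · obtain ⟨A, hA, rfl⟩ := List.mem_map.1 (Multiset.mem_coe.1 hB)
    exact mem_occ_evalSeq E ρ (.inl (mem_of_mem_marked hA)) hx
  · obtain ⟨A, hA, rfl⟩ := List.mem_map.1 (Multiset.mem_coe.1 hB)
    exact mem_occ_evalSeq E ρ (.inr (mem_of_mem_marked hA)) hx

theorem Supports.join {E : Rules L} {M : FOStruct.{u} L} {S : Fin N → EndSeq L} {β : Fin N}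
    {b : Bool} {J : PLink S β b → List Bool → List Bool → NClTerm L} {ρ : PEnv L b (S β).params}
    {t t' : ClTerm S β b} {T T' : PTree L} {P P' Q : (∀ s, FOVar s → M.dom s) → Prop}
    (C : FOSeq L) (mark : Bool) (h : Supports M T (t.eval E J ρ) P)
    (h' : Supports M T' (t'.eval E J ρ) P') (hplus : mark = true → ∀ v, P v → P' v → Q v)
    (htimes : mark = false → ∀ v, P v ∨ P' v → Q v) :
    Supports M (.binary C T T') ((ClTerm.join mark t t').eval E J ρ) Q := by
  cases mark with
  | true => exact h.plus C h' (hplus rfl)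
  | false => exact h.times C h' (htimes rfl)

set_option maxHeartbeats 1000000 in
/-- The evaluated characteristic term of a proof supports the marked subsequent of its end-sequent,
provided that this is so for the proof links. -/
theorem LKS.supports_marked {E : Rules L} (M : FOStruct.{u} L) {S : Fin N → EndSeq L} {β : Fin N}
    {b : Bool} (n : ℕ) (args : Args L (S β).params) (JT : PLink S β b → PTree L)
    (JC : PLink S β b → List Bool → List Bool → NClTerm L)
    (hJ : ∀ l m m', m.length = l.ant.length → m'.length = l.suc.length →
      Supports M (JT l) (JC l m m')
        fun v => MarkedTrue E M m m' l.ant l.suc (semEnv M (paramEnv b n args) v))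
    {Γ Δ : List (Form L (PVar b (S β).params))} (p : LKS E S β b Γ Δ) :
    ∀ m m', m.length = Γ.length → m'.length = Δ.length →
      Supports M (p.tree JT (paramEnv b n args))
        ((p.charTerm m m').eval E JC (paramEnv b n args))
        fun v => MarkedTrue E M m m' Γ Δ (semEnv M (paramEnv b n args) v) := by
  induction p with
  | ax A hA =>
    intro m m' _ _
    refine ⟨?_, fun _ v hv => ?_⟩
    · rintro _ rfl s x hx
      exact occ_evalSeq_marked E _ hx
    · exact (holds_evalSeq_marked E M _ _ _ _ _ v).1 (hv v (fun _ _ _ => rfl) _ rfl)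
  | link l => exact hJ l
  | exL i p ih =>
    intro m m' h h'
    rw [length_swapAt] at h
    refine (ih (swapAt i m) m' (by rwa [length_swapAt]) h').unary _ fun v => ?_
    simp only [MarkedTrue, allMarked_swapAt _ _ _ _ h, imp_self]
  | exR i p ih =>
    intro m m' h h'
    rw [length_swapAt] at h'
    refine (ih m (swapAt i m') h (by rwa [length_swapAt])).unary _ fun v => ?_
    simp only [MarkedTrue, someMarked_swapAt _ _ _ _ h', imp_self]
  | @negL Γ Δ A p ih =>
    intro m m' h h'
    refine (ih m.tail (m.headD false :: m') (by simp [h]) (by simp [h'])).unary _ fun v => ?_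
    simp only [MarkedTrue, allMarked_cons, someMarked_cons, List.headD_cons, List.tail_cons,
      fmSem, Fm.sem]
    tauto
  | @negR Γ Δ A p ih =>
    intro m m' h h'
    refine (ih (m'.headD false :: m) m'.tail (by simp [h]) (by simp [h'])).unary _ fun v => ?_
    simp only [MarkedTrue, allMarked_cons, someMarked_cons, List.headD_cons, List.tail_cons,
      fmSem, Fm.sem]
    tauto
  | @andL1 Γ Δ A B p ih =>
    intro m m' h h'
    refine (ih m m' h h').unary _ fun v => ?_
    simp only [MarkedTrue, allMarked_cons, fmSem, Fm.sem]
    tauto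
  | @andL2 Γ Δ B A p ih =>
    intro m m' h h'
    refine (ih m m' h h').unary _ fun v => ?_
    simp only [MarkedTrue, allMarked_cons, fmSem, Fm.sem]
    tauto
  | @andR Γ Δ Γ' Δ' A B p q ihp ihq =>
    intro m m' h h'
    simp only [List.length_append, List.length_cons] at h h'
    refine (ihp (m.take Γ.length) (m'.headD false :: m'.tail.take Δ.length) ?_ ?_).join _ _
      (ihq (m.drop Γ.length) (m'.headD false :: m'.tail.drop Δ.length) ?_ ?_) ?_ ?_
    · simp; omega
    · simp; omega
    · simp; omega
    · simp; omega
    · intro hm v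
      simp only [MarkedTrue, allMarked_append, someMarked_append, someMarked_cons, hm,
        List.headD_cons, List.tail_cons, fmSem, Fm.sem]
      tauto
    · intro hm v
      simp only [MarkedTrue, allMarked_append, someMarked_append, someMarked_cons, hm,
        List.headD_cons, List.tail_cons, fmSem, Fm.sem]
      tauto
  | @orL Γ Δ Γ' Δ' A B p q ihp ihq =>
    intro m m' h h'
    simp only [List.length_append, List.length_cons] at h h'
    refine (ihp (m.headD false :: m.tail.take Γ.length) (m'.take Δ.length) ?_ ?_).join _ _
      (ihq (m.headD false :: m.tail.drop Γ.length) (m'.drop Δ.length) ?_ ?_) ?_ ?_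
    · simp; omega
    · simp; omega
    · simp; omega
    · simp; omega
    · intro hm v
      simp only [MarkedTrue, allMarked_append, someMarked_append, allMarked_cons, hm,
        List.headD_cons, List.tail_cons, fmSem, Fm.sem]
      tauto
    · intro hm v
      simp only [MarkedTrue, allMarked_append, someMarked_append, allMarked_cons, hm,
        List.headD_cons, List.tail_cons, fmSem, Fm.sem]
      tauto
  | @orR1 Γ Δ A B p ih =>
    intro m m' h h'
    refine (ih m m' h h').unary _ fun v => ?_
    simp only [MarkedTrue, someMarked_cons, fmSem, Fm.sem]
    tauto
  | @orR2 Γ Δ B A p ih =>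
    intro m m' h h'
    refine (ih m m' h h').unary _ fun v => ?_
    simp only [MarkedTrue, someMarked_cons, fmSem, Fm.sem]
    tauto
  | @impL Γ Δ Γ' Δ' A B p q ihp ihq =>
    intro m m' h h'
    simp only [List.length_append, List.length_cons] at h h'
    refine (ihp (m.tail.take Γ.length) (m.headD false :: m'.take Δ.length) ?_ ?_).join _ _
      (ihq (m.headD false :: m.tail.drop Γ.length) (m'.drop Δ.length) ?_ ?_) ?_ ?_
    · simp; omega
    · simp; omega
    · simp; omega
    · simp; omega
    · intro hm v
      simp only [MarkedTrue, allMarked_append, someMarked_append, allMarked_cons, someMarked_cons,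
        hm, List.headD_cons, List.tail_cons, fmSem, Fm.sem]
      tauto
    · intro hm v
      simp only [MarkedTrue, allMarked_append, someMarked_append, allMarked_cons, someMarked_cons,
        hm, List.headD_cons, List.tail_cons, fmSem, Fm.sem]
      tauto
  | @impR Γ Δ A B p ih =>
    intro m m' h h'
    refine (ih (m'.headD false :: m) m' (by simp [h]) h').unary _ fun v => ?_
    simp only [MarkedTrue, allMarked_cons, someMarked_cons, List.headD_cons, List.tail_cons,
      fmSem, Fm.sem]
    tauto
  | @allL Γ Δ s A t p ih =>
    intro m m' h h'
    refine (ih m m' h h').unary _ fun v hv hall => ?_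
    rw [allMarked_cons] at hall
    refine hv ((allMarked_cons _ _ _ _).2 ⟨fun hm => ?_, hall.2⟩)
    exact (fmSem_instantiate E M _ A t).2 (hall.1 hm _)
  | @allR Γ Δ s A e _ _ _ p ih =>
    intro m m' h h'
    refine (ih m m' h h').unary_eigen _ _ fun hx v hv hall => ?_
    rw [someMarked_cons]
    by_contra hno
    obtain ⟨hA, hΔ⟩ := not_or.1 hno
    -- the premise is refuted where the eigenvariable has a value refuting the matrix
    have hd : ∃ d : M.dom s, m'.headD false = true →
        ¬ fmSem E M (extendSEnv (semEnv M (paramEnv b n args) v) d) A := by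
      by_cases hm : m'.headD false = true
      · obtain ⟨d, hd⟩ := not_forall.1 fun hall => hA ⟨hm, hall⟩
        exact ⟨d, fun _ => hd⟩
      · exact ⟨(M.dom_nonempty s).some, fun h => absurd h hm⟩
    obtain ⟨d, hd⟩ := hd
    obtain ⟨v', hv'd, hv'⟩ := exists_update_eigen E n args e v d
    have hcong := fun B hB => fmSem_congr_of_not_occ E M _ hx hv' (A := B) hB
    rcases (someMarked_cons _ _ _ _).1 (hv v' hv' ((allMarked_congr _ _ fun B hB =>
      hcong B (.inl hB)).2 hall)) with ⟨hm, hs⟩ | hs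
    · refine hd hm ?_
      rw [fmSem_instantiate, hv'd] at hs
      refine (fmSem_extendSEnv_congr E M _ A d fun s' y hy => hv' s' y ?_).1 hs
      intro heq
      rw [← heq] at hx
      refine hx (mem_occ_evalSeq E _ (.inr List.mem_cons_self) ?_)
      rw [fmVal_all]; exact hy
    · exact hΔ ((someMarked_congr _ _ fun B hB =>
        hcong B (.inr (List.mem_cons_of_mem _ hB))).1 hs)
  | @exL_quant Γ Δ s A e _ _ _ p ih =>
    intro m m' h h'
    refine (ih m m' h h').unary_eigen _ _ fun hx v hv hall => ?_
    rw [allMarked_cons] at hall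
    -- the eigenvariable is given the value of a witness
    have hd : ∃ d : M.dom s, m.headD false = true →
        fmSem E M (extendSEnv (semEnv M (paramEnv b n args) v) d) A := by
      by_cases hm : m.headD false = true
      · obtain ⟨d, hd⟩ := hall.1 hm
        exact ⟨d, fun _ => hd⟩
      · exact ⟨(M.dom_nonempty s).some, fun h => absurd h hm⟩
    obtain ⟨d, hd⟩ := hd
    obtain ⟨v', hv'd, hv'⟩ := exists_update_eigen E n args e v d
    have hcong := fun B hB => fmSem_congr_of_not_occ E M _ hx hv' (A := B) hB
    refine (someMarked_congr _ _ fun B hB => hcong B (.inr hB)).1 (hv v' hv' ?_)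
    refine (allMarked_cons _ _ _ _).2 ⟨fun hm => ?_, (allMarked_congr _ _ fun B hB =>
      hcong B (.inl (List.mem_cons_of_mem _ hB))).2 hall.2⟩
    rw [fmSem_instantiate, hv'd]
    refine (fmSem_extendSEnv_congr E M _ A d fun s' y hy => hv' s' y ?_).2 (hd hm)
    intro heq
    rw [← heq] at hx
    refine hx (mem_occ_evalSeq E _ (.inl List.mem_cons_self) ?_)
    rw [fmVal_ex]; exact hy
  | @exR_quant Γ Δ s A t p ih =>
    intro m m' h h'
    refine (ih m m' h h').unary _ fun v hv hall => ?_
    rcases (someMarked_cons _ _ _ _).1 (hv hall) with ⟨hm, hs⟩ | hs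
    · exact (someMarked_cons _ _ _ _).2 (.inl ⟨hm, _, (fmSem_instantiate E M _ A t).1 hs⟩)
    · exact (someMarked_cons _ _ _ _).2 (.inr hs)
  | @weakL Γ Δ A p ih =>
    intro m m' h h'
    refine (ih m.tail m' (by simp [h]) h').unary _ fun v => ?_
    simp only [MarkedTrue, allMarked_cons]
    tauto
  | @weakR Γ Δ A p ih =>
    intro m m' h h'
    refine (ih m m'.tail h (by simp [h'])).unary _ fun v => ?_
    simp only [MarkedTrue, someMarked_cons]
    tauto
  | @contrL Γ Δ A p ih =>
    intro m m' h h'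
    refine (ih (m.headD false :: m) m' (by simpa using h) h').unary _ fun v => ?_
    simp only [MarkedTrue, allMarked_cons, List.headD_cons, List.tail_cons]
    tauto
  | @contrR Γ Δ A p ih =>
    intro m m' h h'
    refine (ih m (m'.headD false :: m') h (by simpa using h')).unary _ fun v => ?_
    simp only [MarkedTrue, someMarked_cons, List.headD_cons, List.tail_cons]
    tauto
  | @cut Γ Δ Γ' Δ' A p q ihp ihq =>
    intro m m' h h'
    simp only [List.length_append] at h h'
    refine (ihp (m.take Γ.length) (true :: m'.take Δ.length) ?_ ?_).join _ _
      (ihq (true :: m.drop Γ.length) (m'.drop Δ.length) ?_ ?_) ?_ (fun hm => nomatch hm)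
    · simp; omega
    · simp; omega
    · simp; omega
    · simp; omega
    · intro _ v
      simp only [MarkedTrue, allMarked_append, someMarked_append, allMarked_cons, someMarked_cons,
        List.headD_cons, List.tail_cons]
      tauto
  | @eqL Γ Δ A A' hE p ih =>
    intro m m' h h'
    refine (ih m m' h h').unary _ fun v => ?_
    simp only [MarkedTrue, allMarked_cons, hE.fmSem_iff M, imp_self]
  | @eqR Γ Δ A A' hE p ih =>
    intro m m' h h'
    refine (ih m m' h h').unary _ fun v => ?_
    simp only [MarkedTrue, someMarked_cons, hE.fmSem_iff M, imp_self]

/-! ### Proof schemata -/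

theorem markedTrue_map_subst (E : Rules L) (M : FOStruct.{u} L) {V W : Kind → Type}
    (σ : ∀ κ, V κ → Term L W κ) (ρ : ∀ κ, W κ → SVal M κ) (m m' : List Bool)
    (Γ Δ : List (Form L V)) :
    MarkedTrue E M m m' (Γ.map (subst σ)) (Δ.map (subst σ)) ρ ↔
      MarkedTrue E M m m' Γ Δ fun κ x => tmSem E M ρ (σ κ x) := by
  simp only [MarkedTrue, allMarked_map, someMarked_map, fmSem_subst]

/-- Substituting terms for the parameter and the formal arguments amounts to passing to the values of
these terms. -/
theorem tmSem_paramSub (E : Rules L) (M : FOStruct.{u} L) {b : Bool} {ps qs : List Kind} (n k : ℕ)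
    (args : Args L qs) (a : Term L (PVar b qs) .arith)
    (ts : ∀ i : Fin ps.length, Term L (PVar b qs) (ps.get i)) (v : ∀ s, FOVar s → M.dom s)
    (ha : tmSem E M (semEnv M (paramEnv b n args) v) a = (ULift.up k : ULift ℕ)) :
    (fun κ x => tmSem E M (semEnv M (paramEnv b n args) v) (paramSub a ts κ x)) =
      semEnv M (paramEnv true k fun i => tmVal E (paramEnv b n args) (ts i)) v := by
  funext κ x
  cases x with
  | k => exact ha
  | arg i => exact (sem_tmVal E M v _ _).symm
  | fv s i => rfl
  | sv X => rfl

theorem tmSem_ofKVar (E : Rules L) (M : FOStruct.{u} L) {b : Bool} {qs : List Kind} (n : ℕ)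
    (args : Args L qs) (a : Term L (KVar b) .arith) (v : ∀ s, FOVar s → M.dom s) :
    tmSem E M (semEnv M (paramEnv b n args) v) (a.subst (fun _ h => h) ofKVar) =
      (ULift.up (tmVal E (kEnv b n) a) : ULift ℕ) := by
  rw [tmSem_subst]
  refine Eq.trans ?_ (sem_tmVal E M v (kEnv b n) a).symm
  congr 1; funext κ x; cases x; rfl

variable {E : Rules L}

theorem ProofSchema.treeVal_zero (Ψ : ProofSchema E N) (β : Fin (N + 1))
    (args : Args L (Ψ.S β).params) :
    Ψ.treeVal β 0 args = (Ψ.base β).tree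
      (PLink.value E (fun _ => .leaf ⟨0, 0⟩) (fun γ _ => Ψ.treeVal γ) 0 (paramEnv false 0 args))
      (paramEnv false 0 args) := by
  rw [treeVal, WellFounded.fix_eq]; rfl

theorem ProofSchema.treeVal_succ (Ψ : ProofSchema E N) (β : Fin (N + 1)) (k : ℕ)
    (args : Args L (Ψ.S β).params) :
    Ψ.treeVal β (k + 1) args = (Ψ.step β).tree
      (PLink.value E (Ψ.treeVal β k) (fun γ _ => Ψ.treeVal γ) k (paramEnv true k args))
      (paramEnv true k args) := by
  have h : ∀ n, Ψ.treeVal β n = _ := fun n => by rw [treeVal, WellFounded.fix_eq]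
  rw [h (k + 1), h k]; rfl

theorem ProofSchema.clVal_zero (Ψ : ProofSchema E N) (β : Fin (N + 1))
    (args : Args L (Ψ.S β).params) (m m' : List Bool) :
    Ψ.clVal β 0 args m m' = ((Ψ.base β).charTerm m m').eval E
      (PLink.value E (fun _ _ _ => .clause ⟨0, 0⟩) (fun γ _ => Ψ.clVal γ) 0
        (paramEnv false 0 args)) (paramEnv false 0 args) := by
  rw [clVal, WellFounded.fix_eq]; rfl

theorem ProofSchema.clVal_succ (Ψ : ProofSchema E N) (β : Fin (N + 1)) (k : ℕ)
    (args : Args L (Ψ.S β).params) (m m' : List Bool) :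
    Ψ.clVal β (k + 1) args m m' = ((Ψ.step β).charTerm m m').eval E
      (PLink.value E (Ψ.clVal β k) (fun γ _ => Ψ.clVal γ) k (paramEnv true k args))
      (paramEnv true k args) := by
  have h : ∀ n, Ψ.clVal β n = _ := fun n => by rw [clVal, WellFounded.fix_eq]
  rw [h (k + 1), h k]; rfl

/-- Induction on the proof symbol, downwards, and on the parameter: proof links lead to later symbols,
or to the same symbol and a smaller parameter. -/
theorem ProofSchema.supports_marked (Ψ : ProofSchema E N) (M : FOStruct.{u} L) (β : Fin (N + 1))
    (n : ℕ) (args : Args L (Ψ.S β).params) (m m' : List Bool)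
    (hm : m.length = (Ψ.S β).ant.length) (hm' : m'.length = (Ψ.S β).suc.length) :
    Supports M (Ψ.treeVal β n args) (Ψ.clVal β n args m m') fun v =>
      MarkedTrue E M m m' (Ψ.S β).ant (Ψ.S β).suc (semEnv M (paramEnv true n args) v) := by
  induction β using (wellFounded_gt (α := Fin (N + 1))).induction generalizing n m m' with
  | _ β IH =>
    induction n generalizing args m m' with
    | zero =>
      rw [treeVal_zero, clVal_zero]
      refine ((Ψ.base β).supports_marked M 0 args _ _ ?_ m m' (by simpa) (by simpa)).mono ?_
      · intro l m m' h h'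
        cases l with
        | later γ hγ a ts =>
          simp only [PLink.ant, PLink.suc, List.length_map] at h h'
          refine (IH γ hγ _ _ m m' h h').mono fun v hv => ?_
          simp only [PLink.ant, PLink.suc, markedTrue_map_subst]
          rwa [tmSem_paramSub E M 0 _ args _ ts v (tmSem_ofKVar E M 0 args a v)]
      · intro v hv
        rw [markedTrue_map_subst, tmSem_paramSub E M 0 0 args _ _ v rfl] at hv
        exact hv
    | succ k ih =>
      rw [treeVal_succ, clVal_succ]
      refine ((Ψ.step β).supports_marked M k args _ _ ?_ m m' (by simpa) (by simpa)).mono ?_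
      · intro l m m' h h'
        cases l with
        | self ts =>
          simp only [PLink.ant, PLink.suc, List.length_map] at h h'
          refine (ih _ m m' h h').mono fun v hv => ?_
          simp only [PLink.ant, PLink.suc, markedTrue_map_subst]
          rwa [tmSem_paramSub E M k k args _ ts v rfl]
        | later γ hγ a ts =>
          simp only [PLink.ant, PLink.suc, List.length_map] at h h'
          refine (IH γ hγ _ _ m m' h h').mono fun v hv => ?_
          simp only [PLink.ant, PLink.suc, markedTrue_map_subst]
          rwa [tmSem_paramSub E M k _ args _ ts v (tmSem_ofKVar E M k args a v)]
      · intro v hv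
        rw [markedTrue_map_subst, tmSem_paramSub E M k (k + 1) args _ _ v rfl] at hv
        exact hv

end Soundness

end Ceres

theorem mainTheorem2 {L : Ceres.Sym} (E : Ceres.Rules L) (N : ℕ) (Ψ : Ceres.ProofSchema E N)
    (hΨ : Ψ.IsRegular) (γ : ℕ) : ¬ Ceres.Satisfiable.{u} (Ψ.CL γ) := by
  rintro ⟨M, hM⟩
  have h := Ψ.supports_marked M 0 γ (fun i => Ceres.formalVal i _)
    ((Ψ.S 0).ant.map fun _ => false) ((Ψ.S 0).suc.map fun _ => false) (by simp) (by simp)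
  have hv := h.2 (hΨ γ) (fun s _ => (M.dom_nonempty s).some) fun v' _ C hC => hM C hC v'
  -- nothing is marked in the end-sequent, so its marked subsequent is the empty sequent
  simp only [Ceres.MarkedTrue, Ceres.AllMarked, Ceres.SomeMarked,
    Ceres.marked_eq_nil_of_forall_false] at hv
  simp at hv
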